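/- Let $S$ be a semigroup and $E\subseteq S$ a commutative subsemigroup of idempotents. For $a,b\in S$ write $a\,\widetilde{\mathcal L}\,b$ if $a$ and $b$ have the same right identities in $E$ (for all $e\in E$: $ae=a\iff be=b$), write $a\,\widetilde{\mathcal R}\,b$ if they have the same left identities in $E$, and put $\widetilde{\mathcal H}=\widetilde{\mathcal L}\cap\widetilde{\mathcal R}$. The semigroup $S$ is Ehresmann (with set of projections $E$) if every $\widetilde{\mathcal L}$-class and every $\widetilde{\mathcal R}$-class contains exactly one element of $E$, $\widetilde{\mathcal L}$ is a right congruence and $\widetilde{\mathcal R}$ is a left congruence; $a^{*}$ denotes the element of $E$ in the $\widetilde{\mathcal L}$-class of $a$. It is right restriction if $ea=a(ea)^{*}$ for all $e\in E$, $a\in S$, and EI-Ehresmann if the $\widetilde{\mathcal H}$-class of every $e\in E$ is a group. For $e\in E$ let $\widetilde{\mathcal L}(e)$ be the $\widetilde{\mathcal L}$-class of $e$ and let $G_e$ be the maximal subgroup of $S$ with unit $e$, that is, Green's $\mathcal H$-class of $e$. Let $\Bbbk\widetilde{\mathcal L}(e)$ be the vector space with basis $\widetilde{\mathcal L}(e)$.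 It is a $\Bbbk S$-$\Bbbk G_e$-bimodule: $s\in S$ maps a basis element $x$ to $sx$ if $sx\in\widetilde{\mathcal L}(e)$ and to $0$ otherwise, and $G_e$ acts by right multiplication. For a finite Ehresmann semigroup $S$ the semigroup algebra $\Bbbk S$ has a unit. All modules are unital finite-dimensional left modules. A $\mathcal J$-class (for Green's relation $\mathcal J$) is regular if it contains an element $a$ with $aba=a$ for some $b\in S$. **Theorem.** Let $S$ be a finite right restriction EI-Ehresmann semigroup with set of projections $E$, and let $\Bbbk$ be a field in which the order of every subgroup of $S$ is invertible. 1. For every $e\in E$ and every simple $\Bbbk G_e$-module $V$, the $\Bbbk S$-module $\Bbbk\widetilde{\mathcal L}(e)\otimes_{\Bbbk G_e}V$ is projective and indecomposable. 2. Every indecomposable projective $\Bbbk S$-module is isomorphic to $\Bbbk\widetilde{\mathcal L}(e)\otimes_{\Bbbk G_e}V$ for some $e\in E$ and some simple $\Bbbk G_e$-module $V$. 3. There is a set $I\subseteq E$ that contains exactly one element of each regular $\mathcal J$-class of $S$. For every such $I$, every indecomposable projective $\Bbbk S$-module is isomorphic to $\Bbbk\widetilde{\mathcal L}(e)\otimes_{\Bbbk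 G_e}V$ for some $e\in I$ and some simple $\Bbbk G_e$-module $V$. This list has no repetitions: for $e_1,e_2\in I$ and simple $\Bbbk G_{e_i}$-modules $V_i$, one has $\Bbbk\widetilde{\mathcal L}(e_1)\otimes_{\Bbbk G_{e_1}}V_1\cong\Bbbk\widetilde{\mathcal L}(e_2)\otimes_{\Bbbk G_{e_2}}V_2$ as $\Bbbk S$-modules if and only if $e_1=e_2$ and $V_1\cong V_2$ as $\Bbbk G_{e_1}$-modules. -/

import Mathlib

universe u v w w₁ w₂

namespace EhresmannRep

/-! ### Green's relations and subgroups of a semigroup -/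

section Green

variable {S : Type u} [Semigroup S]

/-- Green's relation `R`: `a S¹ = b S¹`, where `S¹ = WithOne S` is `S` with a formal unit adjoined. -/
def GreenR (a b : S) : Prop :=
  Set.range (fun x : WithOne S => (a : WithOne S) * x) =
    Set.range (fun x : WithOne S => (b : WithOne S) * x)

/-- Green's relation `L`: `S¹ a = S¹ b`. -/
def GreenL (a b : S) : Prop :=
  Set.range (fun x : WithOne S => x * (a : WithOne S)) =
    Set.range (fun x : WithOne S => x * (b : WithOne S))

/-- Green's relation `H`, the intersection of `R` and `L`. -/
def GreenH (a b : S) : Prop := GreenR a b ∧ GreenL a b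

/-- Green's relation `J`: `S¹ a S¹ = S¹ b S¹`. -/
def GreenJ (a b : S) : Prop :=
  Set.range (fun p : WithOne S × WithOne S => p.1 * (a : WithOne S) * p.2) =
    Set.range (fun p : WithOne S × WithOne S => p.1 * (b : WithOne S) * p.2)

/-- `a` is a regular element: `a b a = a` for some `b`. -/
def IsRegularElement (a : S) : Prop := ∃ b : S, a * b * a = a

/-- The subset `H` of the semigroup `S` is a group under the multiplication of `S`
(its unit need not be a unit for `S`). -/
def IsSubgroup (H : Set S) : Prop :=
  (∀ a ∈ H, ∀ b ∈ H, a * b ∈ H) ∧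
    ∃ i ∈ H, ∀ a ∈ H, i * a = a ∧ a * i = a ∧ ∃ b ∈ H, a * b = i ∧ b * a = i

theorem greenH_iff {a e : S} (he : e * e = e) :
    GreenH a e ↔
      e * a = a ∧ a * e = a ∧ ∃ b, e * b = b ∧ b * e = b ∧ a * b = e ∧ b * a = e := by
  have he' : (e : WithOne S) * e = e := by rw [← WithOne.coe_mul, he]
  constructor
  · rintro ⟨hR, hL⟩
    have h1 : (a : WithOne S) ∈ Set.range (fun x : WithOne S => (e : WithOne S) * x) :=
      hR ▸ ⟨1, mul_one _⟩
    have h2 : (e : WithOne S) ∈ Set.range (fun x : WithOne S => (a : WithOne S) * x) :=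
      hR ▸ ⟨1, mul_one _⟩
    have h3 : (a : WithOne S) ∈ Set.range (fun x : WithOne S => x * (e : WithOne S)) :=
      hL ▸ ⟨1, one_mul _⟩
    have h4 : (e : WithOne S) ∈ Set.range (fun x : WithOne S => x * (a : WithOne S)) :=
      hL ▸ ⟨1, one_mul _⟩
    obtain ⟨p, hp⟩ := h1
    obtain ⟨x, hx⟩ := h2
    obtain ⟨q, hq⟩ := h3
    obtain ⟨y, hy⟩ := h4
    dsimp only at hp hx hq hy
    have hea : (e : WithOne S) * a = a := by rw [← hp, ← mul_assoc, he']
    have hae : (a : WithOne S) * e = a := by rw [← hq, mul_assoc, he']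
    have hb : ∃ b : S, (b : WithOne S) = e * x * e := by
      rcases eq_or_ne x 1 with rfl | hx1
      · exact ⟨e, by rw [mul_one, he']⟩
      · obtain ⟨s, rfl⟩ := WithOne.ne_one_iff_exists.1 hx1
        exact ⟨e * s * e, by rw [WithOne.coe_mul, WithOne.coe_mul]⟩
    obtain ⟨b, hb⟩ := hb
    have hyx : (e : WithOne S) * x = y * e := by rw [← hx, ← mul_assoc, hy, hx]
    refine ⟨WithOne.coe_injective (by simpa using hea), WithOne.coe_injective (by simpa using hae),
      b, WithOne.coe_injective ?_, WithOne.coe_injective ?_, WithOne.coe_injective ?_,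
      WithOne.coe_injective ?_⟩
    · rw [WithOne.coe_mul, hb, ← mul_assoc, ← mul_assoc, he']
    · rw [WithOne.coe_mul, hb, mul_assoc, he']
    · rw [WithOne.coe_mul, hb, ← mul_assoc, ← mul_assoc, hae, hx, he']
    · rw [WithOne.coe_mul, hb, hyx, mul_assoc, mul_assoc, hea, hea, hy]
  · rintro ⟨h1, h2, b, -, -, h5, h6⟩
    have h1' : (e : WithOne S) * a = a := by rw [← WithOne.coe_mul, h1]
    have h2' : (a : WithOne S) * e = a := by rw [← WithOne.coe_mul, h2]
    have h5' : (a : WithOne S) * b = e := by rw [← WithOne.coe_mul, h5]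
    have h6' : (b : WithOne S) * a = e := by rw [← WithOne.coe_mul, h6]
    constructor
    · apply Set.Subset.antisymm
      · rintro _ ⟨x, rfl⟩
        exact ⟨a * x, by simp only [← mul_assoc, h1']⟩
      · rintro _ ⟨x, rfl⟩
        exact ⟨b * x, by simp only [← mul_assoc, h5']⟩
    · apply Set.Subset.antisymm
      · rintro _ ⟨x, rfl⟩
        exact ⟨x * a, by simp only [mul_assoc, h2']⟩
      · rintro _ ⟨x, rfl⟩
        exact ⟨x * b, by simp only [mul_assoc, h6']⟩

end Green

/-! ### Ehresmann semigroups -/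

section Ehresmann

/-- `a` and `b` have the same right identities from `E`. -/
def LTilde {S : Type u} [Semigroup S] (E : Set S) (a b : S) : Prop :=
  ∀ e ∈ E, b * e = b ↔ a * e = a

/-- `a` and `b` have the same left identities from `E`. -/
def RTilde {S : Type u} [Semigroup S] (E : Set S) (a b : S) : Prop :=
  ∀ e ∈ E, e * b = b ↔ e * a = a

/-- An Ehresmann semigroup, with its subsemilattice `proj` of projections. -/
class EhresmannSemigroup (S : Type u) extends Semigroup S where
  /-- the set `E` of projections -/
  proj : Set S
  proj_idem : ∀ e ∈ proj, e * e = e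
  proj_mul_mem : ∀ e ∈ proj, ∀ f ∈ proj, e * f ∈ proj
  proj_comm : ∀ e ∈ proj, ∀ f ∈ proj, e * f = f * e
  existsUnique_lTilde : ∀ a : S, ∃! e, e ∈ proj ∧ LTilde proj a e
  existsUnique_rTilde : ∀ a : S, ∃! e, e ∈ proj ∧ RTilde proj a e
  lTilde_right_congr : ∀ a b c : S, LTilde proj a b → LTilde proj (a * c) (b * c)
  rTilde_left_congr : ∀ a b c : S, RTilde proj a b → RTilde proj (c * a) (c * b)

variable (S : Type u) [EhresmannSemigroup S]

/-- The type of projections of `S`. -/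
abbrev Proj : Type u := (EhresmannSemigroup.proj : Set S)

variable {S}

/-- `a⋆`, the unique projection in the `LTilde`-class of `a`. -/
noncomputable def star (a : S) : S :=
  (EhresmannSemigroup.existsUnique_lTilde a).choose

/-- `a⁺`, the unique projection in the `RTilde`-class of `a`. -/
noncomputable def plus (a : S) : S :=
  (EhresmannSemigroup.existsUnique_rTilde a).choose

theorem Proj.idem (e : Proj S) : (e : S) * e = e := EhresmannSemigroup.proj_idem _ e.2

theorem star_mem (a : S) : star a ∈ (EhresmannSemigroup.proj : Set S) :=
  (EhresmannSemigroup.existsUnique_lTilde a).choose_spec.1.1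

theorem plus_mem (a : S) : plus a ∈ (EhresmannSemigroup.proj : Set S) :=
  (EhresmannSemigroup.existsUnique_rTilde a).choose_spec.1.1

theorem lTilde_star (a : S) : LTilde EhresmannSemigroup.proj a (star a) :=
  (EhresmannSemigroup.existsUnique_lTilde a).choose_spec.1.2

theorem rTilde_plus (a : S) : RTilde EhresmannSemigroup.proj a (plus a) :=
  (EhresmannSemigroup.existsUnique_rTilde a).choose_spec.1.2

theorem mul_star (a : S) : a * star a = a :=
  (lTilde_star a _ (star_mem a)).1 (EhresmannSemigroup.proj_idem _ (star_mem a))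

theorem plus_mul (a : S) : plus a * a = a :=
  (rTilde_plus a _ (plus_mem a)).1 (EhresmannSemigroup.proj_idem _ (plus_mem a))

variable (S)

/-- `S` is right restriction: the right ample identity `e a = a (e a)⋆` holds. -/
def IsRightRestriction : Prop :=
  ∀ e ∈ (EhresmannSemigroup.proj : Set S), ∀ a : S, e * a = a * star (e * a)

/-- `S` is EI-Ehresmann: for every projection `e`, the `HTilde`-class of `e`
(which is the endomorphism monoid of the object `e` in the associated Ehresmann category)
is a group. -/
def IsEI : Prop :=
  ∀ e ∈ (EhresmannSemigroup.proj : Set S),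
    IsSubgroup {a : S | LTilde EhresmannSemigroup.proj a e ∧ RTilde EhresmannSemigroup.proj a e}

variable {S}

/-! ### The maximal subgroup at a projection -/

/-- The maximal subgroup `G_e` of `S` with unit `e`: Green's `H`-class of `e`. -/
abbrev MaxSubgroup (e : Proj S) : Type u := {a : S // GreenH a (e : S)}

namespace MaxSubgroup

variable {e : Proj S}

theorem spec (g : MaxSubgroup e) :
    e * g.1 = g.1 ∧ g.1 * e = g.1 ∧
      ∃ b : S, e * b = b ∧ b * e = b ∧ g.1 * b = e ∧ b * g.1 = e :=
  (greenH_iff e.idem).1 g.2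

/-- The multiplication of `G_e` is the one of `S`, and its unit is `e`. -/
noncomputable instance : Group (MaxSubgroup e) where
  mul g h := ⟨g.1 * h.1, by
    obtain ⟨h1, h2, b, h3, h4, h5, h6⟩ := g.spec
    obtain ⟨k1, k2, c, k3, k4, k5, k6⟩ := h.spec
    refine (greenH_iff e.idem).2 ⟨?_, ?_, c * b, ?_, ?_, ?_, ?_⟩
    · rw [← mul_assoc, h1]
    · rw [mul_assoc, k2]
    · rw [← mul_assoc, k3]
    · rw [mul_assoc, h4]
    · rw [mul_assoc, ← mul_assoc h.1, k5, h3, h5]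
    · rw [mul_assoc, ← mul_assoc b, h6, k1, k6]⟩
  one := ⟨e.1, rfl, rfl⟩
  inv g := ⟨g.spec.2.2.choose, by
    obtain ⟨h1, h2, -⟩ := g.spec
    obtain ⟨h3, h4, h5, h6⟩ := g.spec.2.2.choose_spec
    exact (greenH_iff e.idem).2 ⟨h3, h4, g.1, h1, h2, h6, h5⟩⟩
  mul_assoc g h k := Subtype.ext (mul_assoc g.1 h.1 k.1)
  one_mul g := Subtype.ext g.spec.1
  mul_one g := Subtype.ext g.spec.2.1
  inv_mul_cancel g := Subtype.ext g.spec.2.2.choose_spec.2.2.2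

theorem mul_val (g h : MaxSubgroup e) : (g * h).1 = g.1 * h.1 := rfl

theorem one_val : (1 : MaxSubgroup e).1 = e := rfl

end MaxSubgroup

/-! ### The `LTilde`-class of a projection -/

/-- The class `L̃(e)`. -/
abbrev LTildeClass (e : Proj S) : Type u := {x : S // LTilde EhresmannSemigroup.proj x (e : S)}

/-- If `x ∈ L̃(e)` and `s t x ∈ L̃(e)`, then `t x ∈ L̃(e)`. -/
theorem lTilde_of_mul {e : Proj S} {x s t : S} (hx : LTilde EhresmannSemigroup.proj x (e : S))
    (h : LTilde EhresmannSemigroup.proj (s * t * x) (e : S)) :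
    LTilde EhresmannSemigroup.proj (t * x) (e : S) := by
  intro f hf
  constructor
  · intro h1
    rw [mul_assoc, (hx f hf).1 h1]
  · intro h1
    refine (h f hf).2 ?_
    rw [mul_assoc, mul_assoc, ← mul_assoc t, h1, ← mul_assoc]

/-- The right translation `x ↦ x g` of `L̃(e)` by `g ∈ G_e`. -/
def LTildeClass.rightMul {e : Proj S} (x : LTildeClass e) (g : MaxSubgroup e) : LTildeClass e :=
  ⟨x.1 * g.1, by
    have h := EhresmannSemigroup.lTilde_right_congr _ _ g.1 x.2
    obtain ⟨h1, h2, b, h3, h4, h5, h6⟩ := g.spec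
    rw [h1] at h
    intro f hf
    rw [← h f hf]
    constructor
    · intro h7
      rw [← h2, mul_assoc, h7]
    · intro h7
      rw [← h6, mul_assoc, h7]⟩

end Ehresmann

/-! ### The semigroup algebra -/

section SemigroupAlgebra

variable (k : Type v) [Field k] (S : Type u) [EhresmannSemigroup S]

/-- The semigroup algebra `kS`: the vector space with basis `S`, with the multiplication that
extends the one of `S` bilinearly. -/
abbrev SemigroupAlgebra : Type (max v u) := MonoidAlgebra k S

theorem exists_unit_on_finset (F : Finset (Proj S)) :
    ∃ i : MonoidAlgebra k S,
      (∀ e : Proj S, i * MonoidAlgebra.single (e : S) 1 = MonoidAlgebra.single (e : S) 1 * i) ∧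
      ∀ e ∈ F, i * MonoidAlgebra.single (e : S) 1 = MonoidAlgebra.single (e : S) 1 := by
  classical
  have hcomm : ∀ e f : Proj S,
      (MonoidAlgebra.single (e : S) 1 : MonoidAlgebra k S) * MonoidAlgebra.single (f : S) 1 =
        MonoidAlgebra.single (f : S) 1 * MonoidAlgebra.single (e : S) 1 := by
    intro e f
    rw [MonoidAlgebra.single_mul_single, MonoidAlgebra.single_mul_single,
      EhresmannSemigroup.proj_comm _ e.2 _ f.2]
  have hidem : ∀ e : Proj S,
      (MonoidAlgebra.single (e : S) 1 : MonoidAlgebra k S) * MonoidAlgebra.single (e : S) 1 =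
        MonoidAlgebra.single (e : S) 1 := by
    intro e
    rw [MonoidAlgebra.single_mul_single, e.idem, one_mul]
  induction F using Finset.induction_on with
  | empty => exact ⟨0, by simp, by simp⟩
  | insert e F _ ih =>
    obtain ⟨i, h1, h2⟩ := ih
    refine ⟨i + MonoidAlgebra.single (e : S) 1 - i * MonoidAlgebra.single (e : S) 1, ?_, ?_⟩
    · intro f
      simp only [sub_mul, add_mul, mul_sub, mul_add, h1 f, hcomm e f]
      congr 1
      rw [mul_assoc, hcomm e f, ← mul_assoc, h1 f, mul_assoc]
    · intro f hf
      simp only [sub_mul, add_mul]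
      rcases Finset.mem_insert.1 hf with rfl | hf
      · rw [mul_assoc, hidem]
        abel
      · rw [mul_assoc, hcomm e f, ← mul_assoc, h2 f hf]
        abel

variable [Finite S]

theorem exists_one : ∃ i : SemigroupAlgebra k S, ∀ a, i * a = a ∧ a * i = a := by
  classical
  have : Fintype (Proj S) := Fintype.ofFinite _
  obtain ⟨i, h1, h2⟩ := exists_unit_on_finset k S Finset.univ
  suffices h : ∀ a : MonoidAlgebra k S, i * a = a ∧ a * i = a from ⟨i, h⟩
  intro a
  induction a using MonoidAlgebra.induction_linear with
  | zero => simp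
  | add x y hx hy => exact ⟨by rw [mul_add, hx.1, hy.1], by rw [add_mul, hx.2, hy.2]⟩
  | single s c =>
    have hp := h2 ⟨plus s, plus_mem s⟩ (Finset.mem_univ _)
    have hs := h2 ⟨star s, star_mem s⟩ (Finset.mem_univ _)
    rw [h1] at hs
    constructor
    · have : (MonoidAlgebra.single s c : MonoidAlgebra k S) =
          MonoidAlgebra.single (plus s) 1 * MonoidAlgebra.single s c := by
        rw [MonoidAlgebra.single_mul_single, plus_mul, one_mul]
      rw [this, ← mul_assoc]
      exact congrArg (· * _) hp
    · have : (MonoidAlgebra.single s c : MonoidAlgebra k S) =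
          MonoidAlgebra.single s c * MonoidAlgebra.single (star s) 1 := by
        rw [MonoidAlgebra.single_mul_single, mul_star, mul_one]
      rw [this, mul_assoc]
      exact congrArg (_ * ·) hs

/-- `S` need not have a unit, but for finite `S` the algebra `kS` has one. -/
noncomputable instance : Ring (SemigroupAlgebra k S) :=
  { (inferInstance : NonUnitalRing (SemigroupAlgebra k S)) with
    one := (exists_one k S).choose
    one_mul := fun a => ((exists_one k S).choose_spec a).1
    mul_one := fun a => ((exists_one k S).choose_spec a).2 }

end SemigroupAlgebra

/-! ### The bimodule `k L̃(e)` -/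

section Bimodule

variable (k : Type v) [Field k] {S : Type u} [EhresmannSemigroup S]

/-- `k L̃(e)`, the vector space with basis `L̃(e)`. -/
abbrev LTildeModule (e : Proj S) : Type (max u v) := LTildeClass e →₀ k

variable (e : Proj S)

open Classical in
/-- `s ∈ S` maps a basis element `x` to `s x` if `s x ∈ L̃(e)`, and to `0` otherwise. -/
noncomputable def leftOp (s : S) : Module.End k (LTildeModule k e) :=
  Finsupp.lift (LTildeModule k e) k (LTildeClass e) fun x =>
    if h : LTilde EhresmannSemigroup.proj (s * x.1) (e : S) then
      Finsupp.single (⟨s * x.1, h⟩ : LTildeClass e) (1 : k) else (0 : LTildeClass e →₀ k)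

open Classical in
theorem leftOp_single (s : S) (x : LTildeClass e) :
    leftOp k e s (Finsupp.single x (1 : k) : LTildeClass e →₀ k) =
      if h : LTilde EhresmannSemigroup.proj (s * x.1) (e : S) then
        Finsupp.single (⟨s * x.1, h⟩ : LTildeClass e) (1 : k) else (0 : LTildeClass e →₀ k) := by
  unfold leftOp
  refine (Finsupp.sum_single_index ?_).trans ?_
  · exact zero_smul k _
  · exact one_smul k _

variable {k e} in
theorem end_ext {f g : Module.End k (LTildeModule k e)}
    (h : ∀ x : LTildeClass e, f (Finsupp.single x (1 : k) : LTildeClass e →₀ k) =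
      g (Finsupp.single x (1 : k) : LTildeClass e →₀ k)) : f = g :=
  Finsupp.lhom_ext' (M := k) (N := LTildeModule k e) fun x => LinearMap.ext_ring (h x)

theorem leftOp_mul (s t : S) : leftOp k e (s * t) = leftOp k e s * leftOp k e t := by
  classical
  refine end_ext fun x => ?_
  rw [Module.End.mul_apply, leftOp_single, leftOp_single]
  by_cases h : LTilde EhresmannSemigroup.proj (t * x.1) (e : S)
  · rw [dif_pos h, leftOp_single]
    simp only [mul_assoc]
  · rw [dif_neg h, dif_neg fun h' => h (lTilde_of_mul x.2 h')]
    exact (map_zero (leftOp k e s)).symm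

/-- The linear extension of `leftOp` to `kS`. -/
noncomputable def leftHom : MonoidAlgebra k S →ₙₐ[k] Module.End k (LTildeModule k e) :=
  MonoidAlgebra.liftMagma k ⟨leftOp k e, leftOp_mul k e⟩

theorem leftHom_single (s : S) (c : k) :
    leftHom k e (MonoidAlgebra.single s c) = c • leftOp k e s := by
  simp [leftHom, MonoidAlgebra.liftMagma]

theorem leftHom_one [Finite S] : leftHom k e (1 : SemigroupAlgebra k S) = 1 := by
  classical
  refine end_ext fun x => ?_
  have hx : leftHom k e (MonoidAlgebra.single (plus x.1) 1)
      (Finsupp.single x (1 : k) : LTildeClass e →₀ k) =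
      (Finsupp.single x (1 : k) : LTildeClass e →₀ k) := by
    rw [leftHom_single, one_smul, leftOp_single]
    have h : LTilde EhresmannSemigroup.proj (plus x.1 * x.1) (e : S) := by
      rw [plus_mul]; exact x.2
    rw [dif_pos h]
    congr 1
    exact Subtype.ext (plus_mul x.1)
  conv_lhs => rw [← hx]
  rw [← Module.End.mul_apply, ← map_mul]
  rw [one_mul, hx, Module.End.one_apply]

/-- The left `kS`-module structure of `k L̃(e)`. -/
noncomputable instance [Finite S] : Module (SemigroupAlgebra k S) (LTildeModule k e) where
  smul a m := leftHom k e a m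
  one_smul m := by
    change leftHom k e (1 : SemigroupAlgebra k S) m = m
    rw [leftHom_one]; rfl
  mul_smul a b m := by
    change leftHom k e (a * b) m = leftHom k e a (leftHom k e b m)
    exact congrArg (fun f : Module.End k (LTildeModule k e) => f m) (map_mul (leftHom k e) a b)
  smul_zero a := map_zero (leftHom k e a)
  smul_add a := map_add (leftHom k e a)
  add_smul a b m :=
    congrArg (fun f : Module.End k (LTildeModule k e) => f m) (map_add (leftHom k e) a b)
  zero_smul m :=
    congrArg (fun f : Module.End k (LTildeModule k e) => f m) (map_zero (leftHom k e))

/-- `g ∈ G_e` maps a basis element `x` to `x g`. -/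
noncomputable def rightOp (g : MaxSubgroup e) : Module.End k (LTildeModule k e) :=
  Finsupp.lmapDomain k k fun x : LTildeClass e => x.rightMul g

theorem rightOp_single (g : MaxSubgroup e) (x : LTildeClass e) :
    rightOp k e g (Finsupp.single x (1 : k) : LTildeClass e →₀ k) =
      (Finsupp.single (x.rightMul g) (1 : k) : LTildeClass e →₀ k) :=
  Finsupp.mapDomain_single

/-- The linear extension of `rightOp` to the group algebra, an antihomomorphism. -/
noncomputable def rightHom :
    MonoidAlgebra k (MaxSubgroup e) →ₐ[k] (Module.End k (LTildeModule k e))ᵐᵒᵖ :=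
  MonoidAlgebra.lift k (Module.End k (LTildeModule k e))ᵐᵒᵖ (MaxSubgroup e)
    { toFun := fun g => MulOpposite.op (rightOp k e g)
      map_one' := by
        rw [← MulOpposite.op_one]
        congr 1
        refine end_ext fun x => ?_
        rw [rightOp_single, Module.End.one_apply]
        congr 1
        exact Subtype.ext ((x.2 e e.2).1 e.idem)
      map_mul' := fun g h => by
        rw [← MulOpposite.op_mul]
        congr 1
        refine end_ext fun x => ?_
        rw [Module.End.mul_apply, rightOp_single, rightOp_single, rightOp_single]
        congr 1
        exact Subtype.ext (mul_assoc x.1 g.1 h.1).symm }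

theorem rightHom_single (g : MaxSubgroup e) (c : k) :
    rightHom k e (MonoidAlgebra.single g c) = c • MulOpposite.op (rightOp k e g) := by
  simp [rightHom]

/-- The right `kG_e`-module structure of `k L̃(e)`. -/
noncomputable instance : Module (MonoidAlgebra k (MaxSubgroup e))ᵐᵒᵖ (LTildeModule k e) where
  smul b m := (rightHom k e b.unop).unop m
  one_smul m := by
    change (rightHom k e 1).unop m = m
    rw [map_one]; rfl
  mul_smul a b m := by
    change (rightHom k e (b.unop * a.unop)).unop m = _
    rw [map_mul]; rfl
  smul_zero b := map_zero (rightHom k e b.unop).unop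
  smul_add b := map_add (rightHom k e b.unop).unop
  add_smul a b m := by
    change (rightHom k e (a.unop + b.unop)).unop m = _
    rw [map_add]; rfl
  zero_smul m := by
    change (rightHom k e 0).unop m = 0
    rw [map_zero]; rfl

theorem leftOp_comm_rightOp (s : S) (g : MaxSubgroup e) :
    leftOp k e s * rightOp k e g = rightOp k e g * leftOp k e s := by
  classical
  refine end_ext fun x => ?_
  rw [Module.End.mul_apply, Module.End.mul_apply, rightOp_single, leftOp_single, leftOp_single]
  by_cases h : LTilde EhresmannSemigroup.proj (s * x.1) (e : S)
  · have h' : LTilde EhresmannSemigroup.proj (s * (x.rightMul g).1) (e : S) := by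
      have := (LTildeClass.rightMul ⟨s * x.1, h⟩ g).2
      change LTilde EhresmannSemigroup.proj (s * x.1 * g.1) (e : S) at this
      rw [mul_assoc] at this
      exact this
    rw [dif_pos h, dif_pos h', rightOp_single]
    congr 1
    exact Subtype.ext (mul_assoc s x.1 g.1).symm
  · have h' : ¬ LTilde EhresmannSemigroup.proj (s * (x.rightMul g).1) (e : S) := by
      intro h'
      apply h
      have h2 : LTilde EhresmannSemigroup.proj (s * x.1 * g.1) (e : S) := by
        rw [mul_assoc]; exact h'
      have h3 := (LTildeClass.rightMul ⟨_, h2⟩ g⁻¹).2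
      change LTilde EhresmannSemigroup.proj (s * x.1 * g.1 * (g⁻¹).1) (e : S) at h3
      rw [mul_assoc, ← MaxSubgroup.mul_val, mul_inv_cancel, MaxSubgroup.one_val, mul_assoc,
        (x.2 e e.2).1 e.idem] at h3
      exact h3
    rw [dif_neg h, dif_neg h']
    exact (map_zero (rightOp k e g)).symm

/-- `k L̃(e)` is a `kS`-`kG_e`-bimodule. -/
instance [Finite S] :
    SMulCommClass (SemigroupAlgebra k S) (MonoidAlgebra k (MaxSubgroup e))ᵐᵒᵖ
      (LTildeModule k e) where
  smul_comm a b m := by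
    have key : ∀ (a : MonoidAlgebra k S) (b : MonoidAlgebra k (MaxSubgroup e)),
        leftHom k e a * (rightHom k e b).unop = (rightHom k e b).unop * leftHom k e a := by
      intro a b
      induction a using MonoidAlgebra.induction_linear with
      | zero => simp
      | add x y hx hy => rw [map_add, add_mul, mul_add, hx, hy]
      | single s c =>
        induction b using MonoidAlgebra.induction_linear with
        | zero => simp
        | add x y hx hy =>
          rw [map_add, MulOpposite.unop_add, add_mul, mul_add, hx, hy]
        | single g d =>
          rw [leftHom_single, rightHom_single, MulOpposite.unop_smul, MulOpposite.unop_op,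
            smul_mul_smul_comm, smul_mul_smul_comm, leftOp_comm_rightOp, mul_comm c d]
    exact congrArg (fun f : Module.End k (LTildeModule k e) => f m) (key a b.unop)

end Bimodule

/-! ### Tensor products over noncommutative rings, indecomposable modules -/

section Modules

open scoped TensorProduct

variable (A : Type u) (B : Type v) [Ring A] [Ring B]
  (M : Type w₁) [AddCommGroup M] [Module A M] [Module Bᵐᵒᵖ M] [SMulCommClass A Bᵐᵒᵖ M]
  (V : Type w₂) [AddCommGroup V] [Module B V]

/-- The relations `(m b) ⊗ v = m ⊗ (b v)`. As `M` is an `A`-`B`-bimodule, the set of the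
differences is stable under `A`, so that it spans the same subgroup with or without `A`. -/
def balancedRelations : Submodule A (M ⊗[ℤ] V) :=
  Submodule.span A {z | ∃ (m : M) (b : B) (v : V),
    z = (MulOpposite.op b • m) ⊗ₜ[ℤ] v - m ⊗ₜ[ℤ] (b • v)}

/-- The tensor product `M ⊗_B V` of an `A`-`B`-bimodule `M` and a left `B`-module `V`,
a left `A`-module. -/
abbrev BalancedTensor : Type (max w₁ w₂) := (M ⊗[ℤ] V) ⧸ balancedRelations A B M V

/-- A module is indecomposable if it is nonzero and not the direct sum of two nonzero
submodules. -/
def IsIndecomposable : Prop :=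
  Nontrivial M ∧ ∀ p q : Submodule A M, IsCompl p q → p = ⊥ ∨ q = ⊥

end Modules

section Induced

variable (k : Type v) [Field k] {S : Type u} [EhresmannSemigroup S] [Finite S]

/-- The `kS`-module `k L̃(e) ⊗_{kG_e} V`. -/
abbrev Induced (e : Proj S) (V : Type w) [AddCommGroup V]
    [Module (MonoidAlgebra k (MaxSubgroup e)) V] : Type (max (max u v) w) :=
  BalancedTensor (SemigroupAlgebra k S) (MonoidAlgebra k (MaxSubgroup e)) (LTildeModule k e) V

/-- `I` consists of exactly one projection from each regular `J`-class. -/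
def IsTransversal (I : Set (Proj S)) : Prop :=
  ∀ a : S, IsRegularElement a → ∃! e : Proj S, e ∈ I ∧ GreenJ (e : S) a

end Induced

end EhresmannRep

open EhresmannRep

/-! For a `kS`-module `T`, call `t` local at `e` if `e` fixes it and every projection strictly below
`e` kills it. The local elements form `ε_e T`, where `ε_e = e ∏_{f<e} (1 - f)` is an idempotent of
`kS`. The basis vector `e` of `k L̃(e)` is the universal local element: homomorphisms `k L̃(e) → T`
correspond to local elements of `T` (`IsLocal.lift`, `hom_ext_unitVec`). Hence `k L̃(e)` is a
summand of `kS`. By Maschke a simple `V` is a summand of `kG_e`, so the induced module is a summand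
of `k L̃(e)` and is projective.

The right ample identity makes projections act diagonally on `k L̃(e)`: if `f x` is still in
`L̃(e)`, then `f x = x`. So its component at `f` is spanned by the `x` with `x⁺ = f`. For `f = e`
these `x` form the `H̃`-class of `e`, which is `G_e` by EI. Thus the component at `e` of the induced
module is `e ⊗ V`, a copy of `V` (`exists_unitTmul_of_isLocal`), and each of its nonzero elements
generates the module. A sum of two proper submodules is therefore proper (`eq_top_or_eq_top`), which
gives indecomposability. Restricting an isomorphism to components at `e` recovers `V`.

An isomorphism between modules induced from `e₁` and `e₂` gives elements `x`, `y` with `x⁺ = e₁`,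
`x⋆ = e₂`, `y⁺ = e₂`, `y⋆ = e₁`; then EI gives `e₁ J e₂`. For completeness, a simple quotient of an
indecomposable projective `P` has a nonzero component at some projection, which can be moved within
its `J`-class. So some induced module maps onto this quotient, and projectivity on both sides
identifies it with `P`. -/

namespace EhresmannRep

/-! ### Projections, the tilde relations and the groups at projections -/

section Order

variable {S : Type u} [EhresmannSemigroup S]

local notation "E" => (EhresmannSemigroup.proj : Set _)

theorem LTilde.refl (a : S) : LTilde E a a := fun _ _ => Iff.rfl

theorem LTilde.symm {a b : S} (h : LTilde E a b) : LTilde E b a := fun e he => (h e he).symm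

theorem LTilde.trans {a b c : S} (h : LTilde E a b) (h' : LTilde E b c) : LTilde E a c :=
  fun e he => (h' e he).trans (h e he)

theorem RTilde.refl (a : S) : RTilde E a a := fun _ _ => Iff.rfl

theorem RTilde.symm {a b : S} (h : RTilde E a b) : RTilde E b a := fun e he => (h e he).symm

theorem RTilde.trans {a b c : S} (h : RTilde E a b) (h' : RTilde E b c) : RTilde E a c :=
  fun e he => (h' e he).trans (h e he)

theorem eq_of_lTilde (e f : Proj S) (h : LTilde E (e : S) (f : S)) : e = f :=
  Subtype.ext ((EhresmannSemigroup.existsUnique_lTilde (e : S)).unique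
    ⟨e.2, LTilde.refl _⟩ ⟨f.2, h⟩)

/-- `a⋆` as an element of the type of projections. -/
noncomputable def pstar (a : S) : Proj S := ⟨star a, star_mem a⟩

/-- `a⁺` as an element of the type of projections. -/
noncomputable def pplus (a : S) : Proj S := ⟨plus a, plus_mem a⟩

theorem pplus_mul (a : S) : (pplus a : S) * a = a := plus_mul a

theorem mul_pstar (a : S) : a * (pstar a : S) = a := mul_star a

theorem rTilde_pplus (a : S) : RTilde E a (pplus a : S) := rTilde_plus a

theorem lTilde_pstar (a : S) : LTilde E a (pstar a : S) := lTilde_star a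

theorem Proj.mul_comm (e f : Proj S) : (e : S) * f = f * e :=
  EhresmannSemigroup.proj_comm _ e.2 _ f.2

theorem LTilde.mul_proj {e : Proj S} {x : S} (h : LTilde E x (e : S)) : x * e = x :=
  (h e e.2).1 e.idem

theorem RTilde.proj_mul {e : Proj S} {x : S} (h : RTilde E x (e : S)) : (e : S) * x = x :=
  (h e e.2).1 e.idem

/-- The right ample identity forces `f x = x` as soon as `f x` stays in the class of `x`. -/
theorem mul_eq_of_lTilde (hS : IsRightRestriction S) {e : Proj S} {x : S} (f : Proj S)
    (hx : LTilde E x (e : S)) (hfx : LTilde E ((f : S) * x) (e : S)) : (f : S) * x = x := by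
  have h1 := hS f f.2 x
  have h2 : pstar ((f : S) * x) = e := eq_of_lTilde _ _ ((lTilde_pstar _).symm.trans hfx)
  have h3 : star ((f : S) * x) = e := congrArg Subtype.val h2
  rw [h1, h3, hx.mul_proj]

/-- Half of the composition law of the Ehresmann category, in which `x` is an arrow between `x⁺` and
`x⋆`; `mul_mem_rTilde` is the other half. -/
theorem mul_mem_lTilde {e₁ e₂ : Proj S} {x y : S} (hx : LTilde E x (e₂ : S))
    (hx' : (e₁ : S) * x = x) (hy : LTilde E y (e₁ : S)) : LTilde E (y * x) (e₂ : S) := by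
  have h := EhresmannSemigroup.lTilde_right_congr _ _ x hy
  rw [hx'] at h
  exact h.trans hx

theorem mul_mem_rTilde {e₁ e₂ : Proj S} {x y : S} (hx : RTilde E x (e₁ : S))
    (hy' : y * (e₁ : S) = y) (hy : RTilde E y (e₂ : S)) : RTilde E (y * x) (e₂ : S) := by
  have h := EhresmannSemigroup.rTilde_left_congr _ _ y hx
  rw [hy'] at h
  exact h.trans hy

/-- The group supplied by `IsEI` has an unnamed unit. The idempotent `e` lies in it, so it is that
unit, and inverses there are inverses relative to `e`. -/
theorem greenH_of_hTilde (hEI : IsEI S) {e : Proj S} {a : S} (hL : LTilde E a (e : S))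
    (hR : RTilde E a (e : S)) : GreenH a (e : S) := by
  obtain ⟨-, i, -, hi⟩ := hEI e e.2
  obtain ⟨h1, -, b, -, h4, -⟩ := hi e ⟨LTilde.refl _, RTilde.refl _⟩
  have hie : i = e := by
    calc i = (e : S) * b := h4.symm
      _ = e * (e * b) := by rw [← mul_assoc, e.idem]
      _ = e * i := by rw [h4]
      _ = e := (hi e ⟨LTilde.refl _, RTilde.refl _⟩).2.1
  subst hie
  obtain ⟨h1, h2, b, hb, h4, h5⟩ := hi a ⟨hL, hR⟩
  exact (greenH_iff e.idem).2 ⟨h1, h2, b, (hi b hb).1, (hi b hb).2.1, h4, h5⟩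

theorem eq_of_hTilde_of_idem (hEI : IsEI S) {e : Proj S} {a : S} (hL : LTilde E a (e : S))
    (hR : RTilde E a (e : S)) (ha : a * a = a) : a = e := by
  obtain ⟨-, h2, b, -, -, h5, -⟩ := (greenH_iff e.idem).1 (greenH_of_hTilde hEI hL hR)
  rw [← h5, ← ha, mul_assoc, h5, h2, ha]

end Order

/-! ### Green's relation `J` and idempotents in finite semigroups -/

section JClasses

variable {S : Type u} [Semigroup S]

theorem GreenJ.symm {a b : S} (h : GreenJ a b) : GreenJ b a := Eq.symm h

theorem GreenJ.trans {a b c : S} (h : GreenJ a b) (h' : GreenJ b c) : GreenJ a c := Eq.trans h h'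

theorem greenJ_iff {a b : S} :
    GreenJ a b ↔ (∃ p q : WithOne S, p * b * q = (a : WithOne S)) ∧
      ∃ p q : WithOne S, p * a * q = (b : WithOne S) := by
  constructor
  · intro h
    constructor
    · have : (a : WithOne S) ∈
        Set.range (fun p : WithOne S × WithOne S => p.1 * (b : WithOne S) * p.2) :=
        h ▸ ⟨(1, 1), by simp⟩
      obtain ⟨⟨p, q⟩, h⟩ := this
      exact ⟨p, q, h⟩
    · have : (b : WithOne S) ∈
        Set.range (fun p : WithOne S × WithOne S => p.1 * (a : WithOne S) * p.2) :=
        h ▸ ⟨(1, 1), by simp⟩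
      obtain ⟨⟨p, q⟩, h⟩ := this
      exact ⟨p, q, h⟩
  · rintro ⟨⟨p, q, h⟩, p', q', h'⟩
    apply Set.Subset.antisymm
    · rintro _ ⟨⟨x, y⟩, rfl⟩
      exact ⟨(x * p, q * y), by simp only [← h, mul_assoc]⟩
    · rintro _ ⟨⟨x, y⟩, rfl⟩
      exact ⟨(x * p', q' * y), by simp only [← h', mul_assoc]⟩

theorem greenJ_of_mul {a b p q p' q' : S} (h : p * b * q = a) (h' : p' * a * q' = b) :
    GreenJ a b :=
  greenJ_iff.2 ⟨⟨p, q, by rw [← h, WithOne.coe_mul, WithOne.coe_mul]⟩,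
    p', q', by rw [← h', WithOne.coe_mul, WithOne.coe_mul]⟩

/-- Flanking by elements of `S` absorbs the formal unit, so factors from `WithOne S` can be replaced
by elements of `S`. -/
theorem exists_sandwich {e : S} (p : WithOne S) (f : S) : ∃ c : S, (c : WithOne S) = e * p * f := by
  rcases eq_or_ne p 1 with rfl | hp
  · exact ⟨e * f, by simp⟩
  · obtain ⟨s, rfl⟩ := WithOne.ne_one_iff_exists.1 hp
    exact ⟨e * s * f, by simp⟩

/-- If the idempotent `e` lies in the ideal generated by the idempotent `f`,
then it factors through `f`. -/
theorem exists_factorization {e f : S} (he : e * e = e) (hf : f * f = f)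
    (h : ∃ p q : WithOne S, p * f * q = (e : WithOne S)) :
    ∃ a z : S, a * z = e ∧ e * a = a ∧ a * f = a ∧ f * z = z ∧ z * e = z := by
  obtain ⟨p, q, h⟩ := h
  have he' : (e : WithOne S) * e = e := by rw [← WithOne.coe_mul, he]
  have hf' : (f : WithOne S) * f = f := by rw [← WithOne.coe_mul, hf]
  obtain ⟨a, ha⟩ := exists_sandwich (e := e) p f
  obtain ⟨z, hz⟩ := exists_sandwich (e := f) q e
  refine ⟨a, z, ?_, ?_, ?_, ?_, ?_⟩ <;> apply WithOne.coe_injective <;> rw [WithOne.coe_mul]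
  · calc (a : WithOne S) * z = e * (p * (f * f) * q) * e := by rw [ha, hz]; simp only [mul_assoc]
      _ = e := by rw [hf', h, he', he']
  · rw [ha, ← mul_assoc, ← mul_assoc, he']
  · rw [ha, mul_assoc, hf']
  · rw [hz, ← mul_assoc, ← mul_assoc, hf']
  · rw [hz, mul_assoc, he']

/-- One-sided inverses are two-sided by finiteness: `p` undoes left multiplication by `q` on `{s | e
s = s}`, so that map is injective, hence surjective, and a preimage of `e` must be `p`. -/
theorem mul_eq_of_mul_eq [Finite S] {e p q : S} (he : e * e = e) (hpe : p * e = p)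
    (heq : e * q = q) (h : p * q = e) : q * p = e := by
  let φ : {s : S // e * s = s} → {s : S // e * s = s} := fun s => ⟨q * s, by rw [← mul_assoc, heq]⟩
  have hφ : Function.Injective φ := by
    rintro ⟨s, hs⟩ ⟨t, ht⟩ hst
    have h1 : q * s = q * t := congrArg Subtype.val hst
    apply Subtype.ext
    change s = t
    rw [← hs, ← ht, ← h, mul_assoc, h1, mul_assoc]
  obtain ⟨⟨s, hs⟩, hq⟩ := Finite.surjective_of_injective hφ ⟨e, he⟩
  have hq' : q * s = e := congrArg Subtype.val hq
  have : p = s := by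
    calc p = p * e := hpe.symm
      _ = e * s := by rw [← hq', ← mul_assoc, h]; rw [hq']
      _ = s := hs
  rw [this, hq']

/-- In a finite semigroup, `J`-equivalent idempotents are isomorphic. -/
theorem exists_iso_of_greenJ [Finite S] {e f : S} (he : e * e = e) (hf : f * f = f)
    (h : GreenJ e f) :
    ∃ a z y : S, a * z = e ∧ z * y = f ∧ f * z = z ∧ z * e = z := by
  obtain ⟨h1, h2⟩ := greenJ_iff.1 h
  obtain ⟨a, z, haz, -, haf, hfz, hze⟩ := exists_factorization he hf h1
  obtain ⟨c, d, hcd, -, hce, -, -⟩ := exists_factorization hf he h2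
  -- Since `(c a)(z d) = c e d = f`, finiteness gives `(z d)(c a) = f`, so `d c a` is a right
  -- inverse of `z`.
  refine ⟨a, z, d * (c * a), haz, ?_, hfz, hze⟩
  rw [← mul_assoc]
  refine mul_eq_of_mul_eq hf (by rw [mul_assoc, haf]) (by rw [← mul_assoc, hfz]) ?_
  rw [mul_assoc, ← mul_assoc a, haz, ← mul_assoc, hce, hcd]

end JClasses

/-! ### Projections in regular `J`-classes -/

section Regular

variable {S : Type u} [EhresmannSemigroup S]

local notation "E" => (EhresmannSemigroup.proj : Set _)

/-- The projection is `f⁺` for the idempotent `f = a b`. The ample identity yields `f⋆ f = f`, that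
is `f⁺ ≤ f⋆`; then `f f⁺` is an idempotent in the `H̃`-class of `f⁺`, a group, so `f f⁺ = f⁺`.
Together with `f⁺ f = f` this puts `f⁺` in the `J`-class of `a`. -/
theorem exists_greenJ_of_regular (hS : IsRightRestriction S) (hEI : IsEI S) {a : S}
    (ha : IsRegularElement a) : ∃ e : Proj S, GreenJ (e : S) a := by
  obtain ⟨b, hab⟩ := ha
  obtain ⟨f, hf⟩ : ∃ f, f = a * b := ⟨_, rfl⟩
  have hff : f * f = f := by rw [hf, ← mul_assoc, hab]
  have h1 : LTilde E ((pstar f : S) * f) (pstar f : S) := by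
    have h := EhresmannSemigroup.lTilde_right_congr _ _ f (lTilde_pstar f)
    rw [hff] at h
    exact h.symm.trans (lTilde_pstar f)
  have h2 : (pstar f : S) * f = f := mul_eq_of_lTilde hS _ (lTilde_pstar f) h1
  have h3 : (pstar f : S) * pplus f = pplus f := (rTilde_pplus f _ (star_mem f)).2 h2
  have hL : LTilde E (f * pplus f) (pplus f : S) := by
    have h := EhresmannSemigroup.lTilde_right_congr _ _ (pplus f : S) (lTilde_pstar f)
    rwa [h3] at h
  have hR : RTilde E (f * pplus f) (pplus f : S) := by
    have h := EhresmannSemigroup.rTilde_left_congr _ _ f (rTilde_pplus f)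
    rw [hff] at h
    exact h.symm.trans (rTilde_pplus f)
  have h4 : f * pplus f = pplus f := eq_of_hTilde_of_idem hEI hL hR (by
    rw [mul_assoc, ← mul_assoc _ f, pplus_mul, ← mul_assoc, hff])
  have hfa : f * a = a := by rw [hf, hab]
  have hpa : (pplus f : S) * a = a := by rw [← hfa, ← mul_assoc, pplus_mul]
  refine ⟨pplus f, greenJ_of_mul (p := f) (q := b * pplus f) (p' := pplus f) (q' := a) ?_ ?_⟩
  · rw [hfa, ← mul_assoc, ← hf, h4]
  · rw [Proj.idem, hpa]

/-- Projections that are connected by arrows in both directions are `J`-equivalent. -/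
theorem greenJ_of_arrows (hEI : IsEI S) {e₁ e₂ : Proj S} {x y : S} (hxL : LTilde E x (e₂ : S))
    (hxR : RTilde E x (e₁ : S)) (hyL : LTilde E y (e₁ : S)) (hyR : RTilde E y (e₂ : S)) :
    GreenJ (e₁ : S) (e₂ : S) := by
  have key : ∀ {e₁ e₂ : Proj S} {x y : S}, LTilde E x (e₂ : S) → RTilde E x (e₁ : S) →
      LTilde E y (e₁ : S) → RTilde E y (e₂ : S) → ∃ p q : S, p * e₁ * q = e₂ := by
    intro e₁ e₂ x y hxL hxR hyL hyR
    -- The loop `y x` lies in the group at `e₂`; multiplying by its inverse `b` writes `e₂` as `(b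
    -- y) e₁ x`.
    obtain ⟨-, -, b, -, -, -, h⟩ := (greenH_iff e₂.idem).1 (greenH_of_hTilde hEI
      (mul_mem_lTilde hxL hxR.proj_mul hyL) (mul_mem_rTilde hxR hyL.mul_proj hyR))
    exact ⟨b * y, x, by rw [mul_assoc, hxR.proj_mul, mul_assoc, h]⟩
  obtain ⟨p, q, h⟩ := key hxL hxR hyL hyR
  obtain ⟨p', q', h'⟩ := key hyL hyR hxL hxR
  exact greenJ_of_mul h' h

theorem exists_isTransversal (hS : IsRightRestriction S) (hEI : IsEI S) :
    ∃ I : Set (Proj S), IsTransversal I := by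
  let r : Setoid (Proj S) :=
    { r := fun e f => GreenJ (e : S) (f : S)
      iseqv := ⟨fun _ => rfl, GreenJ.symm, GreenJ.trans⟩ }
  refine ⟨Set.range (Quotient.out : Quotient r → Proj S), fun a ha => ?_⟩
  obtain ⟨e, he⟩ := exists_greenJ_of_regular hS hEI ha
  refine ⟨(Quotient.mk r e).out, ⟨⟨_, rfl⟩, GreenJ.trans (Quotient.mk_out (s := r) e) he⟩, ?_⟩
  rintro _ ⟨⟨q, rfl⟩, hq⟩
  congr 1
  rw [← Quotient.out_eq q]
  exact Quotient.sound (s := r) (GreenJ.trans hq he.symm)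

theorem IsTransversal.eq_of_greenJ {I : Set (Proj S)} (hI : IsTransversal I) {e f : Proj S}
    (he : e ∈ I) (hf : f ∈ I) (h : GreenJ (e : S) (f : S)) : e = f :=
  (hI f ⟨f, by rw [f.idem, f.idem]⟩).unique ⟨he, h⟩ ⟨hf, rfl⟩

theorem IsTransversal.exists_greenJ {I : Set (Proj S)} (hI : IsTransversal I) (e : Proj S) :
    ∃ f ∈ I, GreenJ (e : S) (f : S) := by
  obtain ⟨f, ⟨hf, h⟩, -⟩ := hI e ⟨e, by rw [e.idem, e.idem]⟩
  exact ⟨f, hf, h.symm⟩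

end Regular

end EhresmannRep

namespace EhresmannRep

/-! ### Components of modules at projections and the universal property of `k L̃(e)` -/

section LocalElements

variable (k : Type v) [Field k] {S : Type u} [EhresmannSemigroup S]

local notation "E" => (EhresmannSemigroup.proj : Set _)

/-- The basis element of `kS` at `s`. -/
noncomputable def ofS (s : S) : SemigroupAlgebra k S := MonoidAlgebra.single s 1

theorem ofS_mul [Finite S] (s t : S) : ofS k (s * t) = ofS k s * ofS k t := by
  unfold ofS
  rw [MonoidAlgebra.single_mul_single, one_mul]

theorem single_eq_single_mul_ofS [Finite S] (s : S) (c : k) (e : S) (h : s * e = s) :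
    (MonoidAlgebra.single s c : SemigroupAlgebra k S) = MonoidAlgebra.single s c * ofS k e := by
  unfold ofS
  rw [MonoidAlgebra.single_mul_single, mul_one, h]

/-- The inclusion of `k L̃(e)` into `kS` (not a homomorphism of modules). -/
noncomputable def incl (e : Proj S) : LTildeModule k e →+ SemigroupAlgebra k S :=
  Finsupp.liftAddHom fun x => MonoidAlgebra.singleAddHom x.1

theorem incl_single {e : Proj S} (x : LTildeClass e) (d : k) :
    incl k e (Finsupp.single x d) = MonoidAlgebra.single x.1 d := by
  simp [incl]

variable [Finite S]

/-- `t` lies in the component at the object `e` of the module `T`: it is fixed by `e` and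
annihilated by all projections below `e`. -/
def IsLocal (e : Proj S) {T : Type w} [AddCommGroup T] [Module (SemigroupAlgebra k S) T]
    (t : T) : Prop :=
  ofS k (e : S) • t = t ∧ ∀ f : Proj S, (f : S) * e = f → f ≠ e → ofS k (f : S) • t = 0

variable {k}
variable {T : Type w} [AddCommGroup T] [Module (SemigroupAlgebra k S) T]
variable {T' : Type w₁} [AddCommGroup T'] [Module (SemigroupAlgebra k S) T']
variable {e : Proj S}

theorem IsLocal.map {t : T} (ht : IsLocal k e t) (φ : T →ₗ[SemigroupAlgebra k S] T') :
    IsLocal k e (φ t) :=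
  ⟨by rw [← map_smul, ht.1], fun f hf hfe => by rw [← map_smul, ht.2 f hf hfe, map_zero]⟩

/-- From `s e = s` follows `s⋆ ≤ e`, and the inequality is strict outside `L̃(e)`. As `s = s s⋆`,
the action of `s` passes through a projection that kills `t`. -/
theorem IsLocal.single_smul_eq_zero {t : T} (ht : IsLocal k e t) {s : S} (c : k) (hse : s * e = s)
    (hs : ¬ LTilde E s (e : S)) : (MonoidAlgebra.single s c : SemigroupAlgebra k S) • t = 0 := by
  have h1 : (pstar s : S) * e = pstar s := (lTilde_pstar s e e.2).2 hse
  have h2 : pstar s ≠ e := fun h => hs (h ▸ lTilde_pstar s)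
  rw [single_eq_single_mul_ofS k s c (pstar s : S) (mul_pstar s), mul_smul, ht.2 _ h1 h2, smul_zero]

theorem smul_finsupp_single (s : S) (c : k) (x : LTildeClass e) (d : k)
    (h : LTilde E (s * x.1) (e : S)) :
    (MonoidAlgebra.single s c : SemigroupAlgebra k S) •
      (Finsupp.single x d : LTildeModule k e) =
        (Finsupp.single (⟨s * x.1, h⟩ : LTildeClass e) (c * d) : LTildeModule k e) := by
  change leftHom k e (MonoidAlgebra.single s c) (Finsupp.single x d : LTildeClass e →₀ k) = _
  have : (Finsupp.single x d : LTildeClass e →₀ k) = d • Finsupp.single x 1 := by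
    rw [Finsupp.smul_single, smul_eq_mul, mul_one]
  rw [this, map_smul, leftHom_single, LinearMap.smul_apply, leftOp_single, dif_pos h,
    Finsupp.smul_single, Finsupp.smul_single, smul_eq_mul, smul_eq_mul, mul_one, mul_comm]

theorem smul_finsupp_single_eq_zero (s : S) (c : k) (x : LTildeClass e) (d : k)
    (h : ¬ LTilde E (s * x.1) (e : S)) :
    (MonoidAlgebra.single s c : SemigroupAlgebra k S) •
      (Finsupp.single x d : LTildeModule k e) = 0 := by
  change leftHom k e (MonoidAlgebra.single s c) (Finsupp.single x d : LTildeClass e →₀ k) = _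
  have : (Finsupp.single x d : LTildeClass e →₀ k) = d • Finsupp.single x 1 := by
    rw [Finsupp.smul_single, smul_eq_mul, mul_one]
  rw [this, map_smul, leftHom_single, LinearMap.smul_apply, leftOp_single, dif_neg h]
  exact (congrArg (d • ·) (smul_zero c)).trans (smul_zero d)

variable (k e) in
/-- The basis element `e` of `k L̃(e)`. -/
noncomputable def unitVec : LTildeModule k e :=
  Finsupp.single (⟨e, LTilde.refl _⟩ : LTildeClass e) 1

theorem incl_unitVec : incl k e (unitVec k e) = ofS k (e : S) := incl_single k _ _

theorem incl_smul_unitVec (m : LTildeModule k e) : incl k e m • unitVec k e = m := by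
  induction m using Finsupp.induction_linear with
  | zero => rw [map_zero, zero_smul]
  | add x y hx hy => rw [map_add, add_smul, hx, hy]
  | single x d =>
    have h : x.1 * (e : S) = x.1 := x.2.mul_proj
    have h' : LTilde E (x.1 * (e : S)) (e : S) := by rw [h]; exact x.2
    rw [incl_single, unitVec, smul_finsupp_single _ _ _ _ h', mul_one]
    congr 1
    exact Subtype.ext h

theorem isLocal_unitVec : IsLocal k e (unitVec k e) := by
  constructor
  · rw [← incl_unitVec, incl_smul_unitVec]
  · intro f hfe hne
    refine smul_finsupp_single_eq_zero _ _ _ _ fun h => hne ?_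
    change LTilde E ((f : S) * e) (e : S) at h
    rw [hfe] at h
    exact eq_of_lTilde _ _ h

/-- `incl` fails to be linear only at products `s x` that leave `L̃(e)`. Such products still satisfy
`s x e = s x`, so they kill local elements and the failure is invisible on `t`. -/
theorem IsLocal.incl_smul {t : T} (ht : IsLocal k e t) (a : SemigroupAlgebra k S)
    (m : LTildeModule k e) : incl k e (a • m) • t = a • incl k e m • t := by
  induction m using Finsupp.induction_linear with
  | zero => rw [smul_zero, map_zero, zero_smul, smul_zero]
  | add x y hx hy => rw [smul_add, map_add, map_add, add_smul, add_smul, hx, hy, smul_add]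
  | single x d =>
    induction a using MonoidAlgebra.induction_linear with
    | zero =>
      exact (congrArg (fun z => incl k e z • t) (zero_smul _ _)).trans
        (by rw [map_zero, zero_smul]; exact (zero_smul _ _).symm)
    | add a b ha hb =>
      refine (congrArg (fun z => incl k e z • t) (add_smul a b _)).trans ?_
      rw [map_add, add_smul, ha, hb]
      exact (add_smul a b _).symm
    | single s c =>
      have hm : (MonoidAlgebra.single s c : SemigroupAlgebra k S) •
          incl k e (Finsupp.single x d) • t =
          (MonoidAlgebra.single (s * x.1) (c * d) : SemigroupAlgebra k S) • t := by
        rw [incl_single, ← mul_smul, MonoidAlgebra.single_mul_single]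
      rw [hm]
      by_cases h : LTilde E (s * x.1) (e : S)
      · rw [smul_finsupp_single _ _ _ _ h, incl_single]
      · rw [smul_finsupp_single_eq_zero _ _ _ _ h, map_zero, zero_smul,
          ht.single_smul_eq_zero _ _ h]
        rw [mul_assoc, x.2.mul_proj]

/-- The homomorphism from `k L̃(e)` that maps the basis element `e` to the local element `t`. -/
noncomputable def IsLocal.lift {t : T} (ht : IsLocal k e t) :
    LTildeModule k e →ₗ[SemigroupAlgebra k S] T where
  toFun m := incl k e m • t
  map_add' x y := by rw [map_add, add_smul]
  map_smul' a m := ht.incl_smul a m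

theorem IsLocal.lift_apply {t : T} (ht : IsLocal k e t) (m : LTildeModule k e) :
    ht.lift m = incl k e m • t := rfl

theorem IsLocal.lift_unitVec {t : T} (ht : IsLocal k e t) : ht.lift (unitVec k e) = t := by
  rw [ht.lift_apply, incl_unitVec, ht.1]

/-- The uniqueness half of the universal property: the vector `e` generates `k L̃(e)`. -/
theorem hom_ext_unitVec {f g : LTildeModule k e →ₗ[SemigroupAlgebra k S] T}
    (h : f (unitVec k e) = g (unitVec k e)) : f = g := by
  ext1 m
  rw [← incl_smul_unitVec m, map_smul, map_smul, h]

variable (k e) in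
/-- The left ideal spanned by the projections strictly below `e`. -/
noncomputable def belowIdeal : Ideal (SemigroupAlgebra k S) :=
  Ideal.span {a | ∃ f : Proj S, (f : S) * e = f ∧ f ≠ e ∧ a = ofS k (f : S)}

theorem IsLocal.smul_eq_zero {t : T} (ht : IsLocal k e t) {a : SemigroupAlgebra k S}
    (ha : a ∈ belowIdeal k e) : a • t = 0 := by
  unfold belowIdeal at ha
  induction ha using Submodule.span_induction with
  | mem x hx =>
    obtain ⟨f, h1, h2, rfl⟩ := hx
    exact ht.2 f h1 h2
  | zero => exact zero_smul _ _
  | add x y _ _ hx hy => rw [add_smul, hx, hy, add_zero]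
  | smul a x _ hx => rw [smul_eq_mul, mul_smul, hx, smul_zero]

theorem ofS_proj_comm (f g : Proj S) : ofS k (f : S) * ofS k (g : S) =
    ofS k (g : S) * ofS k (f : S) := by
  rw [← ofS_mul, ← ofS_mul, Proj.mul_comm]

variable (k e) in
-- The element is `e ∏ (1 - f)` over the projections `f < e`, built one factor at a time. Congruence
-- to `e` modulo `belowIdeal` is what makes it fix all local elements.
theorem exists_local_idem : ∃ ε : SemigroupAlgebra k S, IsLocal k e ε ∧
    ε - ofS k (e : S) ∈ belowIdeal k e ∧ ∀ f : Proj S, ofS k (f : S) * ε = ε * ofS k (f : S) := by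
  classical
  have : Fintype (Proj S) := Fintype.ofFinite _
  suffices h : ∀ F : Finset (Proj S), ∃ ε : SemigroupAlgebra k S, ofS k (e : S) * ε = ε ∧
      (∀ f ∈ F, (f : S) * e = f → f ≠ e → ofS k (f : S) * ε = 0) ∧
      ε - ofS k (e : S) ∈ belowIdeal k e ∧
      ∀ f : Proj S, ofS k (f : S) * ε = ε * ofS k (f : S) by
    obtain ⟨ε, h1, h2, h3, h4⟩ := h Finset.univ
    exact ⟨ε, ⟨h1, fun f => h2 f (Finset.mem_univ f)⟩, h3, h4⟩
  intro F
  induction F using Finset.induction_on with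
  | empty =>
    exact ⟨ofS k (e : S), by rw [← ofS_mul, e.idem], by simp, by simp,
      fun f => ofS_proj_comm f e⟩
  | insert f F _ ih =>
    obtain ⟨ε, h1, h2, h3, h4⟩ := ih
    by_cases hf : (f : S) * e = f ∧ f ≠ e
    · refine ⟨ε - ofS k (f : S) * ε, ?_, ?_, ?_, ?_⟩
      · rw [mul_sub, ← mul_assoc, ofS_proj_comm, mul_assoc, h1]
      · intro g hg hge hgne
        rcases Finset.mem_insert.1 hg with rfl | hg
        · rw [mul_sub, ← mul_assoc, ← ofS_mul, g.idem, sub_self]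
        · rw [mul_sub, ← mul_assoc, ofS_proj_comm, mul_assoc, h2 g hg hge hgne, mul_zero, sub_zero]
      · have h5 : ofS k (f : S) * ε ∈ belowIdeal k e := by
          have : ofS k (f : S) * ε = ofS k (f : S) * (ε - ofS k (e : S)) + ofS k (f : S) := by
            rw [mul_sub, ← ofS_mul, hf.1, sub_add_cancel]
          rw [this]
          exact add_mem (Ideal.mul_mem_left _ _ h3) (Ideal.subset_span ⟨f, hf.1, hf.2, rfl⟩)
        rw [sub_right_comm]
        exact sub_mem h3 h5
      · intro g
        rw [mul_sub, sub_mul, h4 g, ← mul_assoc, ofS_proj_comm, mul_assoc, h4 g, mul_assoc]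
    · refine ⟨ε, h1, ?_, h3, h4⟩
      intro g hg hge hgne
      rcases Finset.mem_insert.1 hg with rfl | hg
      · exact absurd ⟨hge, hgne⟩ hf
      · exact h2 g hg hge hgne

variable (k e) in
/-- The idempotent of `kS` that projects every module onto its component at `e`. -/
noncomputable def localIdem : SemigroupAlgebra k S := (exists_local_idem k e).choose

theorem isLocal_localIdem : IsLocal k e (localIdem k e) := (exists_local_idem k e).choose_spec.1

theorem localIdem_comm (f : Proj S) :
    ofS k (f : S) * localIdem k e = localIdem k e * ofS k (f : S) :=
  (exists_local_idem k e).choose_spec.2.2 f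

theorem IsLocal.localIdem_smul {t : T} (ht : IsLocal k e t) : localIdem k e • t = t := by
  have h := ht.smul_eq_zero (exists_local_idem k e).choose_spec.2.1
  rw [sub_smul, ht.1] at h
  exact sub_eq_zero.1 h

variable (k e) in
theorem isLocal_localIdem_smul (t : T) : IsLocal k e (localIdem k e • t) :=
  isLocal_localIdem.map (LinearMap.toSpanSingleton (SemigroupAlgebra k S) T t)

/-- If `f` does not kill `x`, the ample identity gives `f x = x`, so `x⁺ ≤ f`. Were `x⁺ < f`, then
`x = x⁺ x` would be killed, because `x⁺` annihilates the idempotent at `f` and commutes with it. -/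
theorem pplus_eq_of_localIdem_smul_ne_zero {f : Proj S} {x : LTildeClass e} (d : k)
    (hS : IsRightRestriction S)
    (h : localIdem k f • (Finsupp.single x d : LTildeModule k e) ≠ 0) :
    pplus x.1 = f := by
  have h1 : (f : S) * x.1 = x.1 := by
    refine mul_eq_of_lTilde hS f x.2 (by_contra fun hx => h ?_)
    have h2 := isLocal_localIdem (k := k) (e := f)
    have h3 : localIdem k f = localIdem k f * ofS k (f : S) := by
      rw [← localIdem_comm]; exact h2.1.symm
    rw [h3, mul_smul, ofS, smul_finsupp_single_eq_zero _ _ _ _ hx, smul_zero]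
  by_contra hne
  apply h
  have h2 : (pplus x.1 : S) * f = pplus x.1 := by
    rw [Proj.mul_comm]; exact (rTilde_pplus x.1 f f.2).2 h1
  have h3 : (Finsupp.single x d : LTildeModule k e) =
      ofS k (pplus x.1 : S) • Finsupp.single x d := by
    have h' : LTilde E ((pplus x.1 : S) * x.1) (e : S) := by rw [pplus_mul]; exact x.2
    rw [ofS, smul_finsupp_single _ _ _ _ h', one_mul]
    congr 1
    exact Subtype.ext (pplus_mul x.1).symm
  rw [h3, ← mul_smul, ← localIdem_comm]
  exact (congrArg (· • _) (isLocal_localIdem.2 _ h2 hne)).trans (zero_smul _ _)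

/-- `k L̃(e)` is a direct summand of `kS`. -/
theorem projective_lTildeModule :
    Module.Projective (SemigroupAlgebra k S) (LTildeModule k e) := by
  -- The vector `e` goes to the local idempotent in `kS` and back to itself under `1 ↦ e`, since the
  -- idempotent fixes local elements.
  refine Module.Projective.of_split (isLocal_localIdem (k := k) (e := e)).lift
    (LinearMap.toSpanSingleton (SemigroupAlgebra k S) _ (unitVec k e)) (hom_ext_unitVec ?_)
  rw [LinearMap.comp_apply, IsLocal.lift_unitVec, LinearMap.toSpanSingleton_apply,
    isLocal_unitVec.localIdem_smul, LinearMap.id_apply]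

/-- A nonzero module has a nonzero component at some projection. -/
theorem exists_isLocal_ne_zero [Nontrivial T] : ∃ e : Proj S, ∃ t : T, t ≠ 0 ∧ IsLocal k e t := by
  have h : ∃ e : Proj S, ∃ t : T, ofS k (e : S) • t ≠ 0 := by
    by_contra! h
    obtain ⟨t, ht⟩ := exists_ne (0 : T)
    apply ht
    suffices h' : ∀ a : SemigroupAlgebra k S, a • t = 0 by
      rw [← one_smul (SemigroupAlgebra k S) t, h']
    intro a
    induction a using MonoidAlgebra.induction_linear with
    | zero => exact zero_smul _ _
    | add a b ha hb => exact (add_smul a b t).trans (by rw [ha, hb, add_zero])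
    | single s c =>
      rw [single_eq_single_mul_ofS k s c (pstar s : S) (mul_pstar s), mul_smul, h, smul_zero]
  let r : Proj S → Proj S → Prop := fun f e => (f : S) * e = f ∧ f ≠ e
  have : Std.Irrefl r := ⟨fun e he => he.2 rfl⟩
  have : IsTrans (Proj S) r := ⟨by
    rintro a b c ⟨h1, h2⟩ ⟨h3, h4⟩
    refine ⟨by rw [← h1, mul_assoc, h3], ?_⟩
    rintro rfl
    exact h2 (Subtype.ext (by rw [← h1, Proj.mul_comm, h3]))⟩
  -- For a projection `e` minimal among those not annihilating `T`, every vector `e t` is local.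
  obtain ⟨e, ⟨t, ht⟩, hmin⟩ := (Finite.wellFounded_of_trans_of_irrefl r).has_min
    {e | ∃ t : T, ofS k (e : S) • t ≠ 0} h
  refine ⟨e, _, ht, ?_, fun f hf hfe => ?_⟩
  · rw [← mul_smul, ← ofS_mul, e.idem]
  · by_contra h'
    exact hmin f ⟨_, h'⟩ ⟨hf, hfe⟩

/-- Components at isomorphic projections vanish simultaneously. -/
theorem IsLocal.transport (hS : IsRightRestriction S) {f : Proj S} {t : T} (ht : IsLocal k e t)
    {a z y : S} (haz : a * z = e) (hzy : z * y = f) (hfz : f * z = z) (hze : z * e = z) (h0 : t ≠ 0) :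
    ofS k z • t ≠ 0 ∧ IsLocal k f (ofS k z • t) := by
  refine ⟨fun h => h0 ?_, ?_, fun g hg hgf => ?_⟩
  · rw [← ht.1, ← haz, ofS_mul, mul_smul, h, smul_zero]
  · rw [← mul_smul, ← ofS_mul, hfz]
  · rw [← mul_smul, ← ofS_mul]
    -- If `g z` stayed in `L̃(e)`, the ample identity would give `g z = z e = z`, hence `g = g f = g
    -- z y = z y = f`.
    refine ht.single_smul_eq_zero _ (by rw [mul_assoc, hze]) fun h => hgf ?_
    have h1 : star ((g : S) * z) = e :=
      congrArg Subtype.val (eq_of_lTilde (pstar ((g : S) * z)) e ((lTilde_pstar _).symm.trans h))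
    have h2 : (g : S) * z = z := by rw [hS g g.2 z, h1, hze]
    exact Subtype.ext (by rw [← hg, ← hzy, ← mul_assoc, h2])

end LocalElements

end EhresmannRep

namespace EhresmannRep

/-! ### Calculus of the balanced tensor product -/

section BalancedTensor

open scoped TensorProduct

variable {A : Type u} {B : Type v} [Ring A] [Ring B]
  {M : Type w₁} [AddCommGroup M] [Module A M] [Module Bᵐᵒᵖ M]
  {V : Type w₂} [AddCommGroup V] [Module B V] {N : Type w} [AddCommGroup N] [Module A N]

namespace BalancedTensor

variable (A B) in
/-- The class of `m ⊗ v`. -/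
def tmul (m : M) (v : V) : BalancedTensor A B M V := Submodule.Quotient.mk (m ⊗ₜ[ℤ] v)

theorem add_tmul (m n : M) (v : V) : tmul A B (m + n) v = tmul A B m v + tmul A B n v := by
  unfold tmul
  rw [TensorProduct.add_tmul, Submodule.Quotient.mk_add]

theorem tmul_add (m : M) (v w : V) : tmul A B m (v + w) = tmul A B m v + tmul A B m w := by
  unfold tmul
  rw [TensorProduct.tmul_add, Submodule.Quotient.mk_add]

theorem zero_tmul (v : V) : tmul A B (0 : M) v = 0 := by
  unfold tmul
  rw [TensorProduct.zero_tmul, Submodule.Quotient.mk_zero]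

theorem tmul_zero (m : M) : tmul A B m (0 : V) = 0 := by
  unfold tmul
  rw [TensorProduct.tmul_zero, Submodule.Quotient.mk_zero]

theorem smul_tmul (a : A) (m : M) (v : V) : a • tmul A B m v = tmul A B (a • m) v := rfl

theorem op_smul_tmul (m : M) (b : B) (v : V) :
    tmul A B (MulOpposite.op b • m) v = tmul A B m (b • v) :=
  (Submodule.Quotient.eq _).2 (Submodule.subset_span ⟨m, b, v, rfl⟩)

theorem induction_on {p : BalancedTensor A B M V → Prop} (z : BalancedTensor A B M V)
    (zero : p 0) (tmul : ∀ m v, p (tmul A B m v)) (add : ∀ x y, p x → p y → p (x + y)) : p z := by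
  obtain ⟨z, rfl⟩ := Submodule.Quotient.mk_surjective _ z
  induction z using TensorProduct.induction_on with
  | zero => exact zero
  | tmul m v => exact tmul m v
  | add x y hx hy => exact add _ _ hx hy

theorem hom_ext {f g : BalancedTensor A B M V →ₗ[A] N}
    (h : ∀ m v, f (tmul A B m v) = g (tmul A B m v)) : f = g := by
  refine LinearMap.ext fun z => ?_
  induction z using BalancedTensor.induction_on with
  | zero => rw [map_zero, map_zero]
  | tmul m v => exact h m v
  | add x y hx hy => rw [map_add, map_add, hx, hy]

/-- The homomorphism out of `M ⊗_B V` given by a balanced map. -/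
noncomputable def lift (f : V →+ (M →ₗ[A] N))
    (hf : ∀ (m : M) (b : B) (v : V), f v (MulOpposite.op b • m) = f (b • v) m) :
    BalancedTensor A B M V →ₗ[A] N :=
  (balancedRelations A B M V).liftQ
    (TensorProduct.AlgebraTensorModule.lift
      { toFun := fun m => AddMonoidHom.toIntLinearMap
          { toFun := fun v => f v m
            map_zero' := by rw [map_zero, LinearMap.zero_apply]
            map_add' := fun v w => by rw [map_add, LinearMap.add_apply] }
        map_add' := fun m n => by ext v; exact map_add (f v) m n
        map_smul' := fun a m => by ext v; exact map_smul (f v) a m })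
    (by
      refine Submodule.span_le.2 ?_
      rintro _ ⟨m, b, v, rfl⟩
      rw [SetLike.mem_coe, LinearMap.mem_ker, map_sub, sub_eq_zero]
      exact hf m b v)

end BalancedTensor

end BalancedTensor

/-! ### The component at `e` of an induced module, and its splitting off `k L̃(e)` -/

section Induced

open BalancedTensor

variable {k : Type v} [Field k] {S : Type u} [EhresmannSemigroup S]
variable {e : Proj S}

local notation "E" => (EhresmannSemigroup.proj : Set _)

theorem card_maxSubgroup_ne_zero [Finite S]
    (hk : ∀ H : Set S, IsSubgroup H → IsUnit (Nat.card H : k)) (e : Proj S) :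
    (Nat.card (MaxSubgroup e) : k) ≠ 0 := by
  refine (hk {a | GreenH a (e : S)} ⟨fun a ha b hb => ?_, e, (1 : MaxSubgroup e).2,
    fun a ha => ?_⟩).ne_zero
  · exact ((⟨a, ha⟩ : MaxSubgroup e) * ⟨b, hb⟩).2
  · let g : MaxSubgroup e := ⟨a, ha⟩
    exact ⟨g.spec.1, g.spec.2.1, g⁻¹.1, g⁻¹.2, congrArg Subtype.val (mul_inv_cancel g),
      congrArg Subtype.val (inv_mul_cancel g)⟩

theorem op_single_smul (g : MaxSubgroup e) (c : k) (x : LTildeClass e) (d : k) :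
    MulOpposite.op (MonoidAlgebra.single g c : MonoidAlgebra k (MaxSubgroup e)) •
      (Finsupp.single x d : LTildeModule k e) = Finsupp.single (x.rightMul g) (c * d) := by
  change (rightHom k e (MonoidAlgebra.single g c)).unop
    (Finsupp.single x d : LTildeClass e →₀ k) = _
  have : (Finsupp.single x d : LTildeClass e →₀ k) = d • Finsupp.single x 1 := by
    rw [Finsupp.smul_single, smul_eq_mul, mul_one]
  rw [this, map_smul, rightHom_single, MulOpposite.unop_smul, MulOpposite.unop_op,
    LinearMap.smul_apply, rightOp_single, Finsupp.smul_single, Finsupp.smul_single, smul_eq_mul,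
    smul_eq_mul, mul_one, mul_comm]

theorem op_smul_unitVec (b : MonoidAlgebra k (MaxSubgroup e)) :
    MulOpposite.op b • unitVec k e = Finsupp.mapDomain
      (fun g => LTildeClass.rightMul (⟨e, LTilde.refl _⟩ : LTildeClass e) g) b.coeff := by
  induction b using MonoidAlgebra.induction_linear with
  | zero => simp
  | add a b ha hb =>
    rw [MulOpposite.op_add, add_smul, ha, hb, MonoidAlgebra.coeff_add, Finsupp.mapDomain_add]
  | single g c =>
    rw [unitVec, op_single_smul, mul_one, MonoidAlgebra.coeff_single, Finsupp.mapDomain_single]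

/-- The orbit map `g ↦ e g = g` is injective, so `kG_e` embeds in `k L̃(e)` as the orbit of the
vector `e`. -/
theorem eq_zero_of_op_smul_unitVec {b : MonoidAlgebra k (MaxSubgroup e)}
    (h : MulOpposite.op b • unitVec k e = 0) : b = 0 := by
  rw [op_smul_unitVec, ← Finsupp.mapDomain_zero
    (f := fun g => LTildeClass.rightMul (⟨e, LTilde.refl _⟩ : LTildeClass e) g)] at h
  have h' := Finsupp.mapDomain_injective (fun g g' hg => by
    have h1 : (e : S) * g.1 = e * g'.1 := congrArg Subtype.val hg
    rw [g.spec.1, g'.spec.1] at h1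
    exact Subtype.ext h1) h
  exact MonoidAlgebra.coeff_injective (by rw [h', MonoidAlgebra.coeff_zero])

variable [Finite S]

variable {V : Type w} [AddCommGroup V] [Module (MonoidAlgebra k (MaxSubgroup e)) V]

variable (k) in
/-- Right multiplication by the elements of the group algebra. -/
noncomputable def rightMulHom (e : Proj S) : MonoidAlgebra k (MaxSubgroup e) →+
    (LTildeModule k e →ₗ[SemigroupAlgebra k S] LTildeModule k e) where
  toFun b :=
    { toFun := fun m => MulOpposite.op b • m
      map_add' := smul_add _
      map_smul' := fun a m => (smul_comm a (MulOpposite.op b) m).symm }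
  map_zero' := by ext1 m; exact zero_smul _ m
  map_add' b c := by ext1 m; exact add_smul (MulOpposite.op b) (MulOpposite.op c) m

variable (k V) in
/-- `e ⊗ v`. -/
noncomputable def unitTmul (e : Proj S) [Module (MonoidAlgebra k (MaxSubgroup e)) V] (v : V) :
    Induced k e V :=
  tmul (SemigroupAlgebra k S) (MonoidAlgebra k (MaxSubgroup e)) (unitVec k e) v

theorem isLocal_unitTmul (v : V) : IsLocal k e (unitTmul k V e v) := by
  refine isLocal_unitVec.map
    ({ toFun := fun m => tmul (SemigroupAlgebra k S) (MonoidAlgebra k (MaxSubgroup e)) m v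
       map_add' := fun m n => add_tmul m n v
       map_smul' := fun a m => rfl } : LTildeModule k e →ₗ[SemigroupAlgebra k S] Induced k e V)

theorem incl_smul_unitTmul (m : LTildeModule k e) (v : V) :
    incl k e m • unitTmul k V e v =
      tmul (SemigroupAlgebra k S) (MonoidAlgebra k (MaxSubgroup e)) m v := by
  rw [unitTmul, smul_tmul, incl_smul_unitVec]

/-- The action of `kG_e` on `V` is realised by elements of `kS` on `e ⊗ V`. Hence `kS`-submodules
and `kS`-homomorphisms respect the `kG_e`-structure of `V`. -/
theorem unitTmul_smul (b : MonoidAlgebra k (MaxSubgroup e)) (v : V) :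
    unitTmul k V e (b • v) = incl k e (MulOpposite.op b • unitVec k e) • unitTmul k V e v := by
  rw [incl_smul_unitTmul, unitTmul, op_smul_tmul]

/-- It suffices to apply the local idempotent to `x ⊗ v`. A basis vector `x` that survives has `x⁺ =
e`, so by EI it belongs to `G_e` and can be moved across the tensor sign. -/
theorem exists_unitTmul_of_isLocal (hS : IsRightRestriction S) (hEI : IsEI S) (z : Induced k e V)
    (hz : IsLocal k e z) : ∃ v, z = unitTmul k V e v := by
  suffices h : ∀ z : Induced k e V, ∃ v, localIdem k e • z = unitTmul k V e v by
    obtain ⟨v, hv⟩ := h z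
    exact ⟨v, by rw [← hv, hz.localIdem_smul]⟩
  intro z
  induction z using BalancedTensor.induction_on with
  | zero => exact ⟨0, by rw [smul_zero, unitTmul, tmul_zero]⟩
  | add x y hx hy =>
    obtain ⟨v, hv⟩ := hx
    obtain ⟨w, hw⟩ := hy
    exact ⟨v + w, by rw [smul_add, hv, hw, unitTmul, unitTmul, unitTmul, tmul_add]⟩
  | tmul m v =>
    rw [smul_tmul]
    induction m using Finsupp.induction_linear with
    | zero => exact ⟨0, by rw [smul_zero, zero_tmul, unitTmul, tmul_zero]⟩
    | add x y hx hy =>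
      obtain ⟨v, hv⟩ := hx
      obtain ⟨w, hw⟩ := hy
      exact ⟨v + w, by rw [smul_add, add_tmul, hv, hw, unitTmul, unitTmul, unitTmul, tmul_add]⟩
    | single x d =>
      by_cases h : localIdem k e • (Finsupp.single x d : LTildeModule k e) = 0
      · exact ⟨0, by rw [h, zero_tmul, unitTmul, tmul_zero]⟩
      · have h1 := pplus_eq_of_localIdem_smul_ne_zero d hS h
        have h2 : RTilde E x.1 (e : S) := by
          have h2 := rTilde_pplus x.1
          rwa [h1] at h2
        let g : MaxSubgroup e := ⟨x.1, greenH_of_hTilde hEI x.2 h2⟩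
        have h3 : (Finsupp.single x d : LTildeModule k e) =
            MulOpposite.op (MonoidAlgebra.single g d : MonoidAlgebra k (MaxSubgroup e)) •
              unitVec k e := by
          rw [unitVec, op_single_smul, mul_one]
          congr 1
          exact Subtype.ext g.spec.1.symm
        refine ⟨(MonoidAlgebra.single g d : MonoidAlgebra k (MaxSubgroup e)) • v, ?_⟩
        rw [h3, smul_comm, isLocal_unitVec.localIdem_smul, op_smul_tmul, unitTmul]

section Semisimple

variable [IsSemisimpleRing (MonoidAlgebra k (MaxSubgroup e))]
  [IsSimpleModule (MonoidAlgebra k (MaxSubgroup e)) V]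

/-- The surjection `b ↦ b v₀` from `kG_e` onto the simple module `V` splits because `V` is
projective. -/
theorem exists_section {v₀ : V} (hv₀ : v₀ ≠ 0) :
    ∃ σ : V →ₗ[MonoidAlgebra k (MaxSubgroup e)] MonoidAlgebra k (MaxSubgroup e), ∀ v, σ v • v₀ = v := by
  have : Module.Projective (MonoidAlgebra k (MaxSubgroup e)) V :=
    Module.projective_of_isSemisimpleRing _ _
  obtain ⟨σ, hσ⟩ := Module.projective_lifting_property
    (LinearMap.toSpanSingleton (MonoidAlgebra k (MaxSubgroup e)) V v₀)
    LinearMap.id (IsSimpleModule.toSpanSingleton_surjective _ hv₀)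
  exact ⟨σ, fun v => DFunLike.congr_fun hσ v⟩

/-- The maps are `m ⊗ v ↦ m σ(v)` and `m ↦ m ⊗ v₀`, with `σ` a section of `b ↦ b v₀`. The last
clause shows that `e ⊗ v` vanishes only for `v = 0`. -/
theorem exists_retraction {v₀ : V} (hv₀ : v₀ ≠ 0) :
    ∃ (i : Induced k e V →ₗ[SemigroupAlgebra k S] LTildeModule k e)
      (r : LTildeModule k e →ₗ[SemigroupAlgebra k S] Induced k e V),
      r.comp i = LinearMap.id ∧ ∀ v, i (unitTmul k V e v) = 0 → v = 0 := by
  obtain ⟨σ, hσ⟩ := exists_section (k := k) (e := e) hv₀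
  refine ⟨BalancedTensor.lift ((rightMulHom k e).comp σ.toAddMonoidHom) fun m b v => ?_,
    { toFun := fun m => tmul (SemigroupAlgebra k S) (MonoidAlgebra k (MaxSubgroup e)) m v₀
      map_add' := fun m n => add_tmul m n v₀
      map_smul' := fun a m => rfl }, BalancedTensor.hom_ext fun m v => ?_, fun v hv => ?_⟩
  · change MulOpposite.op (σ v) • MulOpposite.op b • m = MulOpposite.op (σ (b • v)) • m
    rw [map_smul, smul_eq_mul, MulOpposite.op_mul, mul_smul]
  · change tmul (SemigroupAlgebra k S) (MonoidAlgebra k (MaxSubgroup e))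
      (MulOpposite.op (σ v) • m) v₀ = tmul _ _ m v
    rw [op_smul_tmul, hσ]
  · have h : σ v = 0 := eq_zero_of_op_smul_unitVec hv
    rw [← hσ v, h, zero_smul]

end Semisimple

end Induced

end EhresmannRep

namespace EhresmannRep

/-! ### Modules induced from simple modules: locality and isomorphisms -/

section InducedSimple

open BalancedTensor

variable {k : Type v} [Field k] {S : Type u} [EhresmannSemigroup S] [Finite S]
variable {e : Proj S} {V : Type w} [AddCommGroup V] [Module (MonoidAlgebra k (MaxSubgroup e)) V]

theorem unitTmul_add (v w : V) :
    unitTmul k V e (v + w) = unitTmul k V e v + unitTmul k V e w := tmul_add _ _ _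

theorem unitTmul_zero : unitTmul k V e 0 = 0 := tmul_zero _

/-- The homomorphism `m ⊗ v ↦ m ⊗ φ v`. -/
noncomputable def inducedMap {V' : Type w₁} [AddCommGroup V']
    [Module (MonoidAlgebra k (MaxSubgroup e)) V']
    (φ : V →ₗ[MonoidAlgebra k (MaxSubgroup e)] V') :
    Induced k e V →ₗ[SemigroupAlgebra k S] Induced k e V' :=
  BalancedTensor.lift
    { toFun := fun v =>
        { toFun := fun m => tmul _ _ m (φ v)
          map_add' := fun m n => add_tmul m n (φ v)
          map_smul' := fun a m => rfl }
      map_zero' := by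
        ext1 m
        exact (congrArg (tmul _ _ m) (map_zero φ)).trans (tmul_zero m)
      map_add' := fun v w => by
        ext1 m
        exact (congrArg (tmul _ _ m) (map_add φ v w)).trans (tmul_add m _ _) }
    fun m b v => (op_smul_tmul m b (φ v)).trans (congrArg (tmul _ _ m) (map_smul φ b v).symm)

theorem inducedMap_tmul {V' : Type w₁} [AddCommGroup V']
    [Module (MonoidAlgebra k (MaxSubgroup e)) V']
    (φ : V →ₗ[MonoidAlgebra k (MaxSubgroup e)] V') (m : LTildeModule k e) (v : V) :
    inducedMap φ (tmul _ _ m v) = tmul (SemigroupAlgebra k S) _ m (φ v) := rfl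

/-- Isomorphic modules induce isomorphic modules. -/
noncomputable def inducedEquiv {V' : Type w₁} [AddCommGroup V']
    [Module (MonoidAlgebra k (MaxSubgroup e)) V']
    (φ : V ≃ₗ[MonoidAlgebra k (MaxSubgroup e)] V') :
    Induced k e V ≃ₗ[SemigroupAlgebra k S] Induced k e V' :=
  LinearEquiv.ofLinearMap (inducedMap φ.toLinearMap) (inducedMap φ.symm.toLinearMap)
    (BalancedTensor.hom_ext fun m v => by
      rw [LinearMap.comp_apply, inducedMap_tmul, inducedMap_tmul]
      exact congrArg (tmul _ _ m) (φ.apply_symm_apply v))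
    (BalancedTensor.hom_ext fun m v => by
      rw [LinearMap.comp_apply, inducedMap_tmul, inducedMap_tmul]
      exact congrArg (tmul _ _ m) (φ.symm_apply_apply v))

/-- By simplicity `v₀` generates `V`, so all of `e ⊗ V` is reached, and `m ⊗ v` is a multiple of `e
⊗ v`. -/
theorem eq_top_of_unitTmul_mem [IsSimpleModule (MonoidAlgebra k (MaxSubgroup e)) V]
    {N : Submodule (SemigroupAlgebra k S) (Induced k e V)} {v₀ : V}
    (hv₀ : v₀ ≠ 0) (h : unitTmul k V e v₀ ∈ N) : N = ⊤ := by
  have hall : ∀ v, unitTmul k V e v ∈ N := by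
    intro v
    obtain ⟨b, rfl⟩ := IsSimpleModule.toSpanSingleton_surjective
      (MonoidAlgebra k (MaxSubgroup e)) hv₀ v
    rw [LinearMap.toSpanSingleton_apply, unitTmul_smul]
    exact N.smul_mem _ h
  refine eq_top_iff.2 fun z _ => ?_
  induction z using BalancedTensor.induction_on with
  | zero => exact N.zero_mem
  | add x y hx hy => exact N.add_mem (hx trivial) (hy trivial)
  | tmul m v =>
    rw [← incl_smul_unitTmul]
    exact N.smul_mem _ (hall v)

variable [IsSemisimpleRing (MonoidAlgebra k (MaxSubgroup e))]
  [IsSimpleModule (MonoidAlgebra k (MaxSubgroup e)) V]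

theorem unitTmul_eq_zero {v : V} (h : unitTmul k V e v = 0) : v = 0 := by
  by_contra hv
  obtain ⟨i, r, -, hi⟩ := exists_retraction (k := k) (e := e) hv
  exact hv (hi v (by rw [h, map_zero]))

theorem unitTmul_injective : Function.Injective (unitTmul k V e) := by
  intro v w h
  rw [← sub_eq_zero]
  refine unitTmul_eq_zero (k := k) (e := e) ?_
  have := unitTmul_add (k := k) (e := e) (v - w) w
  rw [sub_add_cancel, h] at this
  exact left_eq_add.1 (this.trans (add_comm _ _))

variable (k e V) in
theorem finite_induced : Module.Finite (SemigroupAlgebra k S) (Induced k e V) := by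
  have := IsSimpleModule.nontrivial (MonoidAlgebra k (MaxSubgroup e)) V
  obtain ⟨v, hv⟩ := exists_ne (0 : V)
  have h : Submodule.span (SemigroupAlgebra k S) {unitTmul k V e v} = ⊤ :=
    eq_top_of_unitTmul_mem hv (Submodule.subset_span rfl)
  exact ⟨h ▸ Submodule.fg_span_singleton _⟩

variable (k e V) in
theorem projective_induced : Module.Projective (SemigroupAlgebra k S) (Induced k e V) := by
  have := IsSimpleModule.nontrivial (MonoidAlgebra k (MaxSubgroup e)) V
  obtain ⟨v, hv⟩ := exists_ne (0 : V)
  obtain ⟨i, r, hri, -⟩ := exists_retraction (k := k) (e := e) hv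
  have := projective_lTildeModule (k := k) (e := e)
  exact Module.Projective.of_split i r hri

variable (k e V) in
theorem nontrivial_induced : Nontrivial (Induced k e V) := by
  have := IsSimpleModule.nontrivial (MonoidAlgebra k (MaxSubgroup e)) V
  obtain ⟨v, hv⟩ := exists_ne (0 : V)
  exact ⟨unitTmul k V e v, 0, fun h => hv (unitTmul_eq_zero h)⟩

/-- The sum of two proper submodules of an induced module is proper. -/
theorem eq_top_or_eq_top (hS : IsRightRestriction S) (hEI : IsEI S)
    {N K : Submodule (SemigroupAlgebra k S) (Induced k e V)} (h : N ⊔ K = ⊤) :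
    N = ⊤ ∨ K = ⊤ := by
  have := IsSimpleModule.nontrivial (MonoidAlgebra k (MaxSubgroup e)) V
  obtain ⟨v, hv⟩ := exists_ne (0 : V)
  obtain ⟨n, hn, l, hl, hnl⟩ := Submodule.mem_sup.1
    (h ▸ Submodule.mem_top : unitTmul k V e v ∈ N ⊔ K)
  -- The local idempotent keeps each summand in its submodule and sends it to some `e ⊗ vᵢ`; as `v =
  -- v₁ + v₂ ≠ 0`, one of the two is a generator.
  obtain ⟨v₁, h₁⟩ := exists_unitTmul_of_isLocal hS hEI _ (isLocal_localIdem_smul k e n)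
  obtain ⟨v₂, h₂⟩ := exists_unitTmul_of_isLocal hS hEI _ (isLocal_localIdem_smul k e l)
  have h3 : v = v₁ + v₂ := unitTmul_injective (k := k) (e := e) (by
    rw [unitTmul_add, ← h₁, ← h₂, ← smul_add, hnl, (isLocal_unitTmul v).localIdem_smul])
  by_cases hv₁ : v₁ = 0
  · right
    refine eq_top_of_unitTmul_mem (v₀ := v₂) ?_ (h₂ ▸ K.smul_mem _ hl)
    rintro rfl
    exact hv (by rw [h3, hv₁, add_zero])
  · left
    exact eq_top_of_unitTmul_mem hv₁ (h₁ ▸ N.smul_mem _ hn)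

variable (k e V) in
theorem isIndecomposable_induced (hS : IsRightRestriction S) (hEI : IsEI S) :
    IsIndecomposable (SemigroupAlgebra k S) (Induced k e V) := by
  refine ⟨nontrivial_induced k e V, fun p q h => ?_⟩
  rcases eq_top_or_eq_top hS hEI h.sup_eq_top with rfl | rfl
  · exact Or.inr (top_disjoint.1 h.disjoint)
  · exact Or.inl (disjoint_top.1 h.disjoint)

/-- Isomorphic induced modules come from isomorphic simple modules. -/
theorem nonempty_equiv_of_induced (hS : IsRightRestriction S) (hEI : IsEI S)
    {V' : Type w₁} [AddCommGroup V'] [Module (MonoidAlgebra k (MaxSubgroup e)) V']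
    [IsSimpleModule (MonoidAlgebra k (MaxSubgroup e)) V']
    (α : Induced k e V ≃ₗ[SemigroupAlgebra k S] Induced k e V') :
    Nonempty (V ≃ₗ[MonoidAlgebra k (MaxSubgroup e)] V') := by
  -- Homomorphisms preserve components, so `α` restricts to a map `V → V'`; Schur's lemma then
  -- applies.
  choose φ hφ using fun v : V => exists_unitTmul_of_isLocal hS hEI _
    ((isLocal_unitTmul (k := k) (e := e) v).map α.toLinearMap)
  let ψ : V →ₗ[MonoidAlgebra k (MaxSubgroup e)] V' :=
    { toFun := φ
      map_add' := fun v w => unitTmul_injective (k := k) (e := e) (by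
        rw [unitTmul_add, ← hφ, ← hφ, ← hφ, ← map_add, unitTmul_add])
      map_smul' := fun b v => unitTmul_injective (k := k) (e := e) (by
        rw [RingHom.id_apply, unitTmul_smul, ← hφ, ← hφ, ← map_smul, unitTmul_smul]) }
  have := IsSimpleModule.nontrivial (MonoidAlgebra k (MaxSubgroup e)) V
  obtain ⟨v, hv⟩ := exists_ne (0 : V)
  have hψ : ψ ≠ 0 := fun h => hv (unitTmul_eq_zero (k := k) (e := e) (α.injective (by
    have h1 : φ v = 0 := DFunLike.congr_fun h v
    have h2 := hφ v
    rw [h1, unitTmul_zero] at h2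
    exact h2.trans (map_zero α).symm)))
  exact ⟨LinearEquiv.ofBijective ψ (LinearMap.bijective_of_ne_zero hψ)⟩

/-- An isomorphism of induced modules yields an arrow between the projections. -/
theorem exists_arrow (hS : IsRightRestriction S) {e' : Proj S}
    {V' : Type w₁} [AddCommGroup V'] [Module (MonoidAlgebra k (MaxSubgroup e')) V']
    (α : Induced k e V ≃ₗ[SemigroupAlgebra k S] Induced k e' V') :
    ∃ x : S, LTilde EhresmannSemigroup.proj x (e' : S) ∧
      RTilde EhresmannSemigroup.proj x (e : S) := by
  have := IsSimpleModule.nontrivial (MonoidAlgebra k (MaxSubgroup e)) V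
  obtain ⟨v, hv⟩ := exists_ne (0 : V)
  by_contra! hx
  -- Without such an `x` the module induced from `e'` has zero component at `e`, whereas `α` carries
  -- `e ⊗ v ≠ 0` into it.
  have h0 : ∀ m : LTildeModule k e', localIdem k e • m = 0 := by
    intro m
    induction m using Finsupp.induction_linear with
    | zero => exact smul_zero _
    | add x y hx hy => rw [smul_add, hx, hy, add_zero]
    | single x d =>
      by_contra h
      have h1 := pplus_eq_of_localIdem_smul_ne_zero d hS h
      have h2 := rTilde_pplus x.1
      rw [h1] at h2
      exact hx x.1 x.2 h2
  have h1 : ∀ z : Induced k e' V', localIdem k e • z = 0 := by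
    intro z
    induction z using BalancedTensor.induction_on with
    | zero => exact smul_zero _
    | add x y hx hy => rw [smul_add, hx, hy, add_zero]
    | tmul m v => rw [smul_tmul, h0, zero_tmul]
  refine hv (unitTmul_eq_zero (k := k) (e := e) (α.injective ?_))
  have h2 := ((isLocal_unitTmul (k := k) (e := e) v).map α.toLinearMap).localIdem_smul
  rw [h1] at h2
  exact h2.symm.trans (map_zero α).symm

end InducedSimple

/-! ### Every indecomposable projective is induced -/

section Completeness

variable {k : Type v} [Field k] {S : Type u} [EhresmannSemigroup S] [Finite S]

/-- A module with a nonzero component at `e` receives a nonzero homomorphism from a module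
induced from a simple left ideal of the group algebra. -/
theorem exists_hom_ne_zero {e : Proj S} [IsSemisimpleRing (MonoidAlgebra k (MaxSubgroup e))]
    {T : Type w} [AddCommGroup T] [Module (SemigroupAlgebra k S) T] {t : T} (ht : IsLocal k e t)
    (h0 : t ≠ 0) :
    ∃ V : Submodule (MonoidAlgebra k (MaxSubgroup e)) (MonoidAlgebra k (MaxSubgroup e)),
      IsSimpleModule (MonoidAlgebra k (MaxSubgroup e)) V ∧
      ∃ φ : Induced k e V →ₗ[SemigroupAlgebra k S] T, φ ≠ 0 := by
  by_contra! hV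
  -- For a simple left ideal `V`, the map `m ⊗ b ↦ ht.lift (m b)` is a homomorphism on the induced
  -- module. If all of these vanish, `N` contains every simple left ideal, hence `1`, and `t = 0`.
  let N : Submodule (MonoidAlgebra k (MaxSubgroup e)) (MonoidAlgebra k (MaxSubgroup e)) :=
    { carrier := {b | ∀ m : LTildeModule k e, ht.lift (MulOpposite.op b • m) = 0}
      zero_mem' := fun m => by rw [MulOpposite.op_zero, zero_smul, map_zero]
      add_mem' := fun {a b} ha hb m => by
        rw [MulOpposite.op_add, add_smul, map_add, ha, hb, add_zero]
      smul_mem' := fun c b hb m => by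
        rw [smul_eq_mul, MulOpposite.op_mul, mul_smul, hb] }
  have hN : N = ⊤ := by
    rw [eq_top_iff, ← IsSemisimpleModule.sSup_simples_eq_top]
    refine sSup_le fun V hVs b hb m => ?_
    have h := hV V hVs (BalancedTensor.lift
      { toFun := fun b => ht.lift.comp (rightMulHom k e b.1)
        map_zero' := by rw [ZeroMemClass.coe_zero, map_zero, LinearMap.comp_zero]
        map_add' := fun b c => by rw [Submodule.coe_add, map_add, LinearMap.comp_add] }
      fun m c b => by
        change ht.lift (MulOpposite.op b.1 • MulOpposite.op c • m) =
          ht.lift (MulOpposite.op (c * b.1) • m)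
        rw [MulOpposite.op_mul, mul_smul])
    exact DFunLike.congr_fun h (BalancedTensor.tmul _ _ m (⟨b, hb⟩ : V))
  have h1 : (1 : MonoidAlgebra k (MaxSubgroup e)) ∈ N := hN ▸ Submodule.mem_top
  have h2 := h1 (unitVec k e)
  rw [MulOpposite.op_one, one_smul, ht.lift_unitVec] at h2
  exact h0 h2

theorem exists_equiv_induced (hS : IsRightRestriction S) (hEI : IsEI S)
    (hk : ∀ e : Proj S, (Nat.card (MaxSubgroup e) : k) ≠ 0) {I : Set (Proj S)}
    (hI : ∀ e : Proj S, ∃ f ∈ I, GreenJ (e : S) (f : S))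
    {P : Type w₁} [AddCommGroup P] [Module (SemigroupAlgebra k S) P]
    [Module.Finite (SemigroupAlgebra k S) P] (hP : Module.Projective (SemigroupAlgebra k S) P)
    (hPi : IsIndecomposable (SemigroupAlgebra k S) P) :
    ∃ e ∈ I, ∃ (V : Type (max u v)) (_ : AddCommGroup V)
      (_ : Module (MonoidAlgebra k (MaxSubgroup e)) V),
      IsSimpleModule (MonoidAlgebra k (MaxSubgroup e)) V ∧
      Nonempty (P ≃ₗ[SemigroupAlgebra k S] Induced k e V) := by
  obtain ⟨hnt, hPi⟩ := hPi
  obtain ⟨Q, hQ, -⟩ := (eq_top_or_exists_le_coatom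
    (⊥ : Submodule (SemigroupAlgebra k S) P)).resolve_left bot_ne_top
  have hT : IsSimpleModule (SemigroupAlgebra k S) (P ⧸ Q) := isSimpleModule_iff_isCoatom.2 hQ
  have hTn := IsSimpleModule.nontrivial (SemigroupAlgebra k S) (P ⧸ Q)
  obtain ⟨e₀, t₀, ht₀, hl₀⟩ := exists_isLocal_ne_zero (k := k) (S := S) (T := P ⧸ Q)
  obtain ⟨e, heI, hJ⟩ := hI e₀
  -- The nonzero component at `e₀` is carried to the representative `e ∈ I` of its `J`-class.
  obtain ⟨a, z, y, haz, hzy, hfz, hze⟩ := exists_iso_of_greenJ e₀.idem e.idem hJ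
  obtain ⟨ht, hl⟩ := hl₀.transport hS haz hzy hfz hze ht₀
  have : NeZero (Nat.card (MaxSubgroup e) : k) := ⟨hk e⟩
  obtain ⟨V, hV, φ, hφ⟩ := exists_hom_ne_zero hl ht
  refine ⟨e, heI, V, inferInstance, inferInstance, hV, ?_⟩
  have hφs : Function.Surjective φ := LinearMap.surjective_of_ne_zero hφ
  obtain ⟨ψ, hψ⟩ := Module.projective_lifting_property φ Q.mkQ hφs
  have hψs : Function.Surjective ψ := by
    rw [← LinearMap.range_eq_top]
    -- As `φ ∘ ψ` is the quotient map, the range of `ψ` and the kernel of `φ` span everything; the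
    -- kernel is proper, so the range is not.
    refine (eq_top_or_eq_top hS hEI (N := LinearMap.range ψ) (K := LinearMap.ker φ)
      ?_).resolve_right fun h => hφ (LinearMap.ker_eq_top.1 h)
    refine eq_top_iff.2 fun z _ => ?_
    obtain ⟨p, hp⟩ := Q.mkQ_surjective (φ z)
    refine Submodule.mem_sup.2 ⟨ψ p, ⟨p, rfl⟩, z - ψ p, ?_, by abel⟩
    rw [LinearMap.mem_ker, map_sub, ← hp, ← hψ, LinearMap.comp_apply, sub_self]
  have := projective_induced k e V
  obtain ⟨σ, hσ⟩ := Module.projective_lifting_property ψ LinearMap.id hψs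
  -- Projectivity of the induced module splits `ψ`, and indecomposability of `P` then forces its
  -- kernel to vanish.
  have hc : IsCompl (LinearMap.range σ) (LinearMap.ker ψ) := by
    have hψσ : ∀ z, ψ (σ z) = z := DFunLike.congr_fun hσ
    constructor
    · refine Submodule.disjoint_def.2 ?_
      rintro _ ⟨z, rfl⟩ hz
      rw [LinearMap.mem_ker, hψσ] at hz
      rw [hz, map_zero]
    · refine codisjoint_iff.2 (eq_top_iff.2 fun p _ => ?_)
      refine Submodule.mem_sup.2 ⟨σ (ψ p), ⟨_, rfl⟩, p - σ (ψ p), ?_, by abel⟩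
      rw [LinearMap.mem_ker, map_sub, hψσ, sub_self]
  have hker : LinearMap.ker ψ = ⊥ := by
    refine (hPi _ _ hc).resolve_left fun h => ?_
    obtain ⟨z, hz⟩ := @exists_ne _ (nontrivial_induced k e V) 0
    have h1 : σ z = 0 := DFunLike.congr_fun (LinearMap.range_eq_bot.1 h) z
    have h2 : ψ (σ z) = z := DFunLike.congr_fun hσ z
    exact hz (by rw [← h2, h1, map_zero])
  exact ⟨LinearEquiv.ofBijective ψ ⟨LinearMap.ker_eq_bot.1 hker, hψs⟩⟩

end Completeness

end EhresmannRep

theorem mainTheorem1 {S : Type u} [EhresmannSemigroup S] [Finite S]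
    (hS : IsRightRestriction S) (hEI : IsEI S) (k : Type v) [Field k]
    (hk : ∀ H : Set S, IsSubgroup H → IsUnit (Nat.card H : k)) :
    -- the induced modules are indecomposable projective (and finitely generated)
    (∀ (e : Proj S) (V : Type w) [AddCommGroup V] [Module (MonoidAlgebra k (MaxSubgroup e)) V]
        [IsSimpleModule (MonoidAlgebra k (MaxSubgroup e)) V],
      Module.Finite (SemigroupAlgebra k S) (Induced k e V) ∧
      Module.Projective (SemigroupAlgebra k S) (Induced k e V) ∧
      IsIndecomposable (SemigroupAlgebra k S) (Induced k e V)) ∧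
    -- every indecomposable projective module is of this form
    (∀ (P : Type w₁) [AddCommGroup P] [Module (SemigroupAlgebra k S) P]
        [Module.Finite (SemigroupAlgebra k S) P],
      Module.Projective (SemigroupAlgebra k S) P → IsIndecomposable (SemigroupAlgebra k S) P →
      ∃ (e : Proj S) (V : Type (max u v)) (_ : AddCommGroup V)
        (_ : Module (MonoidAlgebra k (MaxSubgroup e)) V),
        IsSimpleModule (MonoidAlgebra k (MaxSubgroup e)) V ∧
        Nonempty (P ≃ₗ[SemigroupAlgebra k S] Induced k e V)) ∧
    -- one projection from each regular `J`-class can be chosen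
    (∃ I : Set (Proj S), IsTransversal I) ∧
    -- any such choice gives a complete list without repetitions
    (∀ I : Set (Proj S), IsTransversal I →
      (∀ (P : Type w₁) [AddCommGroup P] [Module (SemigroupAlgebra k S) P]
          [Module.Finite (SemigroupAlgebra k S) P],
        Module.Projective (SemigroupAlgebra k S) P →
        IsIndecomposable (SemigroupAlgebra k S) P →
        ∃ e ∈ I, ∃ (V : Type (max u v)) (_ : AddCommGroup V)
          (_ : Module (MonoidAlgebra k (MaxSubgroup e)) V),
          IsSimpleModule (MonoidAlgebra k (MaxSubgroup e)) V ∧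
          Nonempty (P ≃ₗ[SemigroupAlgebra k S] Induced k e V)) ∧
      (∀ e₁ ∈ I, ∀ e₂ ∈ I,
        ∀ (V₁ : Type w) [AddCommGroup V₁] [Module (MonoidAlgebra k (MaxSubgroup e₁)) V₁]
          [IsSimpleModule (MonoidAlgebra k (MaxSubgroup e₁)) V₁]
          (V₂ : Type w₂) [AddCommGroup V₂] [Module (MonoidAlgebra k (MaxSubgroup e₂)) V₂]
          [IsSimpleModule (MonoidAlgebra k (MaxSubgroup e₂)) V₂],
        Nonempty (Induced k e₁ V₁ ≃ₗ[SemigroupAlgebra k S] Induced k e₂ V₂) → e₁ = e₂) ∧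
      (∀ e ∈ I,
        ∀ (V₁ : Type w) [AddCommGroup V₁] [Module (MonoidAlgebra k (MaxSubgroup e)) V₁]
          [IsSimpleModule (MonoidAlgebra k (MaxSubgroup e)) V₁]
          (V₂ : Type w₂) [AddCommGroup V₂] [Module (MonoidAlgebra k (MaxSubgroup e)) V₂]
          [IsSimpleModule (MonoidAlgebra k (MaxSubgroup e)) V₂],
        Nonempty (Induced k e V₁ ≃ₗ[SemigroupAlgebra k S] Induced k e V₂) ↔
          Nonempty (V₁ ≃ₗ[MonoidAlgebra k (MaxSubgroup e)] V₂))) := by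
  have hcard := card_maxSubgroup_ne_zero hk
  have hss : ∀ e : Proj S, IsSemisimpleRing (MonoidAlgebra k (MaxSubgroup e)) := fun e => by
    have : NeZero (Nat.card (MaxSubgroup e) : k) := ⟨hcard e⟩
    infer_instance
  refine ⟨fun e V _ _ _ => ⟨finite_induced k e V, projective_induced k e V,
    isIndecomposable_induced k e V hS hEI⟩, fun P _ _ _ hP hPi => ?_,
    exists_isTransversal hS hEI, fun I hI => ⟨fun P _ _ _ hP hPi => ?_, ?_, ?_⟩⟩
  -- Only the covering of `J`-classes by `I` is needed for completeness, so all projections may be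
  -- taken.
  · obtain ⟨e, -, V, hV⟩ := exists_equiv_induced hS hEI hcard (I := Set.univ)
      (fun e => ⟨e, trivial, rfl⟩) hP hPi
    exact ⟨e, V, hV⟩
  · exact exists_equiv_induced hS hEI hcard hI.exists_greenJ hP hPi
  · rintro e₁ h₁ e₂ h₂ V₁ _ _ _ V₂ _ _ _ ⟨α⟩
    obtain ⟨x, hxL, hxR⟩ := exists_arrow hS α
    obtain ⟨y, hyL, hyR⟩ := exists_arrow hS α.symm
    exact hI.eq_of_greenJ h₁ h₂ (greenJ_of_arrows hEI hxL hxR hyL hyR)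
  · rintro e - V₁ _ _ _ V₂ _ _ _
    exact ⟨fun ⟨α⟩ => nonempty_equiv_of_induced hS hEI α, fun ⟨φ⟩ => ⟨inducedEquiv φ⟩⟩
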